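/- Let $\mathbb{K}$ be $\mathbb{R}$ or $\mathbb{C}$, let $S^1=\mathbb{R}/\mathbb{Z}$ with coordinate $x$, and let $\lambda,\mu\in\mathbb{K}$. Let $\mathcal{F}_\lambda$ be the $\mathbb{K}$-vector space of densities $\varphi=\phi(x)(dx)^\lambda$ with $\phi\in C^\infty(S^1,\mathbb{K})$, on which an orientation-preserving diffeomorphism $f$ of $S^1$ acts by $$\rho^\lambda_{f^{-1}}\bigl(\phi\,(dx)^\lambda\bigr)=(f')^\lambda\,(\phi\circ f)\,(dx)^\lambda .$$ Let $\mathcal{D}^1_{\lambda,\mu}(S^1)$ be the space of first-order operators $A:\mathcal{F}_\lambda\to\mathcal{F}_\mu$, $A(\phi\,(dx)^\lambda)=(a_1\phi'+a_0\phi)(dx)^\mu$ with $a_0,a_1\in C^\infty(S^1,\mathbb{K})$, with the action $\rho^{\lambda,\mu}_f(A)=\rho^\mu_f\circ A\circ\rho^\lambda_{f^{-1}}$. Let $\mathcal{I}^1_{\lambda,\mu}(S^1)$ be the associative $\mathbb{K}$-algebra of all $\mathbb{K}$-linear maps $T:\mathcal{D}^1_{\lambda,\mu}(S^1)\to\mathcal{D}^1_{\lambda,\mu}(S^1)$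 (not assumed local or continuous) that commute with $\rho^{\lambda,\mu}_f$ for every orientation-preserving diffeomorphism $f$ of $S^1$. Let $\mathfrak{a}$ and $\mathfrak{b}$ be the algebras of matrices of the forms $$\begin{pmatrix}a&0\\ b&a\end{pmatrix}\qquad\text{and}\qquad\begin{pmatrix}a&0&0&d\\ 0&a&0&0\\ 0&c&b&0\\ 0&0&0&b\end{pmatrix},\qquad a,b,c,d\in\mathbb{K},$$ respectively, and let $\mathbb{K}^2=\mathbb{K}\oplus\mathbb{K}$ be the direct sum of two copies of the algebra $\mathbb{K}$. Then, as $\mathbb{K}$-algebras, 1. $\mathcal{I}^1_{\lambda,\mu}(S^1)\cong\mathbb{K}^2$ if $\mu-\lambda\neq1$; 2. $\mathcal{I}^1_{\lambda,\mu}(S^1)\cong\mathfrak{a}$ if $\mu-\lambda=1$ and $\lambda\neq0$; 3. $\mathcal{I}^1_{0,1}(S^1)\cong\mathfrak{b}$. -/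

import Mathlib

open scoped ContDiff

noncomputable section

/-! ## The circle `S¹ = ℝ/ℤ`: smooth functions and orientation-preserving diffeomorphisms

Smooth functions on `S¹` are written as smooth `1`-periodic functions of the global coordinate `x`,
and orientation-preserving diffeomorphisms of `S¹` through their lifts to `ℝ`. -/

/-- `C^∞(S¹)` with values in `𝕜`: the algebra of smooth `1`-periodic functions of `x`. -/
def SmoothCircle (𝕜 : Type*) [RCLike 𝕜] : Subalgebra 𝕜 (ℝ → 𝕜) where
  carrier := {φ | ContDiff ℝ ∞ φ ∧ Function.Periodic φ 1}
  mul_mem' h₁ h₂ := ⟨h₁.1.mul h₂.1, h₁.2.mul h₂.2⟩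
  add_mem' h₁ h₂ := ⟨h₁.1.add h₂.1, h₁.2.add h₂.2⟩
  algebraMap_mem' _ := ⟨contDiff_const, fun _ => rfl⟩

/-- An orientation-preserving diffeomorphism of `S¹ = ℝ/ℤ`, given by a lift `f : ℝ → ℝ`:
a smooth bijection with smooth inverse, `f' > 0` and `f (x + 1) = f x + 1`.
Every orientation-preserving diffeomorphism of the circle has such a lift, each such `f` is the lift
of one, and lifts of the same diffeomorphism differ by integers, so that they act in the same way
on periodic functions. -/
structure CircleDiffeo where
  toEquiv : ℝ ≃ ℝ
  smooth_toFun : ContDiff ℝ ∞ toEquiv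
  smooth_invFun : ContDiff ℝ ∞ toEquiv.symm
  deriv_pos : ∀ x, 0 < deriv toEquiv x
  map_add_one : ∀ x, toEquiv (x + 1) = toEquiv x + 1

namespace CircleDiffeo

theorem symm_map_add_one (f : CircleDiffeo) (x : ℝ) :
    f.toEquiv.symm (x + 1) = f.toEquiv.symm x + 1 := by
  rw [Equiv.symm_apply_eq, f.map_add_one, Equiv.apply_symm_apply]

theorem deriv_mul_deriv_symm (f : CircleDiffeo) (x : ℝ) :
    deriv f.toEquiv (f.toEquiv.symm x) * deriv f.toEquiv.symm x = 1 := by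
  have h₁ := (f.smooth_toFun.differentiable (by simp) (f.toEquiv.symm x)).hasDerivAt
  have h₂ := (f.smooth_invFun.differentiable (by simp) x).hasDerivAt
  have h := h₁.comp x h₂
  have e : (f.toEquiv : ℝ → ℝ) ∘ f.toEquiv.symm = id := by ext; simp
  rw [e] at h
  exact h.unique (hasDerivAt_id x)

/-- The inverse diffeomorphism. -/
def symm (f : CircleDiffeo) : CircleDiffeo where
  toEquiv := f.toEquiv.symm
  smooth_toFun := f.smooth_invFun
  smooth_invFun := f.smooth_toFun
  deriv_pos x := by
    have h := f.deriv_mul_deriv_symm x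
    have h' := f.deriv_pos (f.toEquiv.symm x)
    by_contra hc
    nlinarith [mul_nonneg h'.le (sub_nonneg.2 (not_lt.1 hc))]
  map_add_one := f.symm_map_add_one

theorem contDiff_deriv (f : CircleDiffeo) : ContDiff ℝ ∞ (deriv f.toEquiv) :=
  (contDiff_infty_iff_deriv.1 f.smooth_toFun).2

theorem periodic_deriv (f : CircleDiffeo) : Function.Periodic (deriv f.toEquiv) 1 := by
  intro x
  rw [← deriv_comp_add_const]
  have : (fun x => f.toEquiv (x + 1)) = fun x => f.toEquiv x + 1 := funext f.map_add_one
  rw [this, deriv_add_const]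

end CircleDiffeo

variable {𝕜 : Type*} [RCLike 𝕜]

namespace SmoothCircle

/-- The derivative `d/dx` on `C^∞(S¹)`. -/
def D : SmoothCircle 𝕜 →ₗ[𝕜] SmoothCircle 𝕜 where
  toFun φ := ⟨deriv φ.1, (contDiff_infty_iff_deriv.1 φ.2.1).2, fun x => by
    rw [← deriv_comp_add_const, funext φ.2.2]⟩
  map_add' φ ψ := Subtype.ext <| funext fun x =>
    deriv_add (φ.2.1.differentiable (by simp) x) (ψ.2.1.differentiable (by simp) x)
  map_smul' c φ := Subtype.ext <| funext fun x =>
    deriv_const_smul c (φ.2.1.differentiable (by simp) x)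

/-- Composition `φ ↦ φ ∘ f` with a diffeomorphism. -/
def comp (f : CircleDiffeo) : SmoothCircle 𝕜 →ₐ[𝕜] SmoothCircle 𝕜 where
  toFun φ := ⟨fun x => φ.1 (f.toEquiv x), φ.2.1.comp f.smooth_toFun, fun x =>
    (congrArg φ.1 (f.map_add_one x)).trans (φ.2.2 _)⟩
  map_one' := rfl
  map_mul' _ _ := rfl
  map_zero' := rfl
  map_add' _ _ := rfl
  commutes' _ := rfl

end SmoothCircle

/-- The function `(f')^lam = exp (lam log f')` on the circle. -/
def CircleDiffeo.derivPow (f : CircleDiffeo) (lam : 𝕜) : SmoothCircle 𝕜 :=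
  ⟨fun x => NormedSpace.exp (Real.log (deriv f.toEquiv x) • lam), by
    refine ⟨?_, fun x => by simp only [f.periodic_deriv x]⟩
    have h₁ : ContDiff ℝ ∞ (fun x => Real.log (deriv f.toEquiv x) • lam) :=
      (f.contDiff_deriv.log fun x => (f.deriv_pos x).ne').smul contDiff_const
    have h₂ : ContDiff ℝ ∞ (NormedSpace.exp : 𝕜 → 𝕜) :=
      contDiff_iff_contDiffAt.2 fun x => (NormedSpace.exp_analytic (𝕂 := ℝ) x).contDiffAt
    exact h₂.comp h₁⟩

/-! ## Densities and differential operators -/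

/-- The space `F_lam(S¹)` of densities `φ(x) (dx)^lam`, a density being written as its coefficient
`φ` in the global coordinate `x`. -/
abbrev Density (_lam : 𝕜) := SmoothCircle 𝕜

namespace Density

/-- The pull-back `φ (dx)^lam ↦ (f')^lam (φ ∘ f) (dx)^lam` of densities, that is `ρ^lam_{f⁻¹}`. -/
def pullback (lam : 𝕜) (f : CircleDiffeo) : Density lam →ₗ[𝕜] Density lam :=
  LinearMap.mulLeft 𝕜 (f.derivPow lam) ∘ₗ (SmoothCircle.comp f).toLinearMap

/-- The action `ρ^lam_f` of a diffeomorphism `f` on densities. -/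
def rho (lam : 𝕜) (f : CircleDiffeo) : Density lam →ₗ[𝕜] Density lam :=
  pullback lam f.symm

end Density

/-- The differential operator
`φ (dx)^lam ↦ (a_k φ^{(k)} + ⋯ + a_1 φ' + a_0 φ) (dx)^mu`. -/
def diffOp (lam mu : 𝕜) (k : ℕ) (a : Fin (k + 1) → SmoothCircle 𝕜) :
    Density lam →ₗ[𝕜] Density mu :=
  ∑ i : Fin (k + 1), LinearMap.mulLeft 𝕜 (a i) ∘ₗ SmoothCircle.D ^ (i : ℕ)

/-- The space `D^k_{lam,mu}(S¹)` of linear differential operators of order at most `k`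
from `F_lam` to `F_mu`. -/
def DiffOps (k : ℕ) (lam mu : 𝕜) : Submodule 𝕜 (Density lam →ₗ[𝕜] Density mu) where
  carrier := {A | ∃ a : Fin (k + 1) → SmoothCircle 𝕜, A = diffOp lam mu k a}
  zero_mem' := ⟨0, by
    refine LinearMap.ext fun φ => ?_
    simp [diffOp]⟩
  add_mem' := by
    rintro _ _ ⟨a, rfl⟩ ⟨b, rfl⟩
    refine ⟨a + b, LinearMap.ext fun φ => ?_⟩
    simp [diffOp, add_mul, Finset.sum_add_distrib]
  smul_mem' := by
    rintro c _ ⟨a, rfl⟩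
    refine ⟨c • a, LinearMap.ext fun φ => ?_⟩
    simp [diffOp, Finset.smul_sum]

/-- `ρ^mu_f ∘ A ∘ ρ^lam_{f⁻¹}` for an arbitrary linear map `A : F_lam → F_mu`. -/
def conjRho (lam mu : 𝕜) (f : CircleDiffeo) :
    (Density lam →ₗ[𝕜] Density mu) →ₗ[𝕜] (Density lam →ₗ[𝕜] Density mu) where
  toFun A := Density.rho mu f ∘ₗ A ∘ₗ Density.rho lam f.symm
  map_add' A B := by ext; simp
  map_smul' c A := by ext; simp

theorem SmoothCircle.D_mul (φ ψ : SmoothCircle 𝕜) :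
    SmoothCircle.D (φ * ψ) = SmoothCircle.D φ * ψ + φ * SmoothCircle.D ψ :=
  Subtype.ext <| funext fun x =>
    deriv_mul (φ.2.1.differentiable (by simp) x) (ψ.2.1.differentiable (by simp) x)

/-- The chain rule `(φ ∘ f)' = f' (φ' ∘ f)`. -/
theorem SmoothCircle.D_comp (f : CircleDiffeo) :
    ∃ c : SmoothCircle 𝕜, ∀ φ : SmoothCircle 𝕜,
      SmoothCircle.D (SmoothCircle.comp f φ) = c * SmoothCircle.comp f (SmoothCircle.D φ) := by
  have hs : ContDiff ℝ ∞ (fun x => ((deriv f.toEquiv x : ℝ) : 𝕜)) :=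
    (RCLike.ofRealCLM (K := 𝕜)).contDiff.comp f.contDiff_deriv
  refine ⟨⟨fun x => ((deriv f.toEquiv x : ℝ) : 𝕜), hs,
    fun x => by simp only [f.periodic_deriv x]⟩, fun φ => Subtype.ext <| funext fun x => ?_⟩
  have h₁ := (f.smooth_toFun.differentiable (by simp) x).hasDerivAt
  have h₂ := (φ.2.1.differentiable (by simp) (f.toEquiv x)).hasDerivAt
  have h := (h₂.scomp x h₁).deriv
  rw [RCLike.real_smul_eq_coe_mul] at h
  exact h

theorem CircleDiffeo.D_iterate_pullback (lam : 𝕜) (f : CircleDiffeo) (i : ℕ) :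
    ∃ c : ℕ → SmoothCircle 𝕜, ∀ φ : SmoothCircle 𝕜,
      (SmoothCircle.D ^ i) (Density.pullback lam f φ) =
        ∑ j ∈ Finset.range (i + 1), c j * SmoothCircle.comp f ((SmoothCircle.D ^ j) φ) := by
  induction i with
  | zero => exact ⟨fun _ => f.derivPow lam, fun φ => by simp [Density.pullback]⟩
  | succ i ih =>
    obtain ⟨c, hc⟩ := ih
    obtain ⟨e, he⟩ := SmoothCircle.D_comp (𝕜 := 𝕜) f
    refine ⟨fun j => (if j < i + 1 then SmoothCircle.D (c j) else 0) +
      (if j = 0 then 0 else c (j - 1) * e), fun φ => ?_⟩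
    rw [pow_succ', Module.End.mul_apply, hc, map_sum]
    simp only [SmoothCircle.D_mul, he, Finset.sum_add_distrib, add_mul]
    congr 1
    · rw [Finset.sum_range_succ _ (i + 1)]
      simp only [lt_irrefl, if_false, zero_mul, add_zero]
      refine Finset.sum_congr rfl fun j hj => ?_
      rw [if_pos (Finset.mem_range.1 hj)]
    · rw [Finset.sum_range_succ' _ (i + 1)]
      simp [pow_succ', mul_assoc]

/-- The action of diffeomorphisms preserves the space of operators of order at most `k`. -/
theorem conjRho_mem (k : ℕ) (lam mu : 𝕜) (f : CircleDiffeo) (A : Density lam →ₗ[𝕜] Density mu)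
    (hA : A ∈ DiffOps k lam mu) : conjRho lam mu f A ∈ DiffOps k lam mu := by
  have mono : ∀ (b : SmoothCircle 𝕜) (j : ℕ), j < k + 1 →
      (LinearMap.mulLeft 𝕜 b ∘ₗ SmoothCircle.D ^ j : Density lam →ₗ[𝕜] Density mu)
        ∈ DiffOps k lam mu := by
    intro b j hj
    refine ⟨Pi.single ⟨j, hj⟩ b, LinearMap.ext fun φ => ?_⟩
    rw [diffOp, LinearMap.sum_apply, Finset.sum_eq_single ⟨j, hj⟩]
    · simp
    · intro i _ hi
      simp [Pi.single_eq_of_ne hi]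
    · simp
  obtain ⟨a, rfl⟩ := hA
  choose c hc using fun i => CircleDiffeo.D_iterate_pullback lam f i
  have key : conjRho lam mu f (diffOp lam mu k a) =
      ∑ i : Fin (k + 1), ∑ j ∈ Finset.range ((i : ℕ) + 1),
        (LinearMap.mulLeft 𝕜
          (f.symm.derivPow mu * SmoothCircle.comp f.symm (a i * c i j)) ∘ₗ
            SmoothCircle.D ^ j : Density lam →ₗ[𝕜] Density mu) := by
    refine LinearMap.ext fun φ => ?_
    have hcomp : ∀ ψ : SmoothCircle 𝕜,
        SmoothCircle.comp f.symm (SmoothCircle.comp f ψ) = ψ := fun ψ =>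
      Subtype.ext <| funext fun x => congrArg ψ.1 (f.toEquiv.apply_symm_apply x)
    have hss : f.symm.symm = f := rfl
    simp only [conjRho, Density.rho, hss, LinearMap.coe_mk, AddHom.coe_mk, LinearMap.comp_apply,
      diffOp, LinearMap.sum_apply, LinearMap.mulLeft_apply, map_sum]
    refine Finset.sum_congr rfl fun i _ => ?_
    rw [hc, Finset.mul_sum, map_sum]
    refine Finset.sum_congr rfl fun j _ => ?_
    simp only [Density.pullback, LinearMap.comp_apply, LinearMap.mulLeft_apply,
      AlgHom.toLinearMap_apply, map_mul, hcomp]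
    ring
  rw [key]
  refine Submodule.sum_mem _ fun i _ => Submodule.sum_mem _ fun j hj => mono _ _ ?_
  have := Finset.mem_range.1 hj
  omega

/-- The action `ρ^{lam,mu}_f : A ↦ ρ^mu_f ∘ A ∘ ρ^lam_{f⁻¹}` on `D^k_{lam,mu}(S¹)`. -/
def diffOpsAction (k : ℕ) (lam mu : 𝕜) (f : CircleDiffeo) :
    Module.End 𝕜 (DiffOps k lam mu) :=
  (conjRho lam mu f).restrict (conjRho_mem k lam mu f)

/-- The algebra of symmetries `I^k_{lam,mu}(S¹)`: the algebra of all linear endomorphisms `T` of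
`D^k_{lam,mu}(S¹)` (not assumed local or continuous) that commute with the action of every
orientation-preserving diffeomorphism. -/
def symmetryAlgebra (k : ℕ) (lam mu : 𝕜) : Subalgebra 𝕜 (Module.End 𝕜 (DiffOps k lam mu)) :=
  Subalgebra.centralizer 𝕜 (Set.range (diffOpsAction k lam mu))

/-! ## The matrix algebras -/

/-- The algebra `𝔞` of matrices `(a 0; b a)`. -/
def algA (𝕜 : Type*) [RCLike 𝕜] : Subalgebra 𝕜 (Matrix (Fin 2) (Fin 2) 𝕜) where
  carrier := {M | ∃ a b : 𝕜, M = !![a, 0; b, a]}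
  mul_mem' := by
    rintro _ _ ⟨a, b, rfl⟩ ⟨a', b', rfl⟩
    exact ⟨a * a', b * a' + a * b', by simp⟩
  add_mem' := by
    rintro _ _ ⟨a, b, rfl⟩ ⟨a', b', rfl⟩
    exact ⟨a + a', b + b', by simp⟩
  algebraMap_mem' r := ⟨r, 0, by
    ext i j; fin_cases i <;> fin_cases j <;> simp [Matrix.algebraMap_matrix_apply]⟩

/-- The algebra `𝔟` of matrices `(a 0 0 d; 0 a 0 0; 0 c b 0; 0 0 0 b)`. -/
def algB (𝕜 : Type*) [RCLike 𝕜] : Subalgebra 𝕜 (Matrix (Fin 4) (Fin 4) 𝕜) where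
  carrier := {M | ∃ a b c d : 𝕜,
    M = !![a, 0, 0, d;
           0, a, 0, 0;
           0, c, b, 0;
           0, 0, 0, b]}
  mul_mem' := by
    rintro _ _ ⟨a, b, c, d, rfl⟩ ⟨a', b', c', d', rfl⟩
    refine ⟨a * a', b * b', c * a' + b * c', a * d' + d * b', ?_⟩
    ext i j
    fin_cases i <;> fin_cases j <;> simp [Matrix.mul_apply, Fin.sum_univ_four]
  add_mem' := by
    rintro _ _ ⟨a, b, c, d, rfl⟩ ⟨a', b', c', d', rfl⟩
    refine ⟨a + a', b + b', c + c', d + d', ?_⟩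
    ext i j
    fin_cases i <;> fin_cases j <;> simp
  algebraMap_mem' r := ⟨r, r, 0, 0, by
    ext i j; fin_cases i <;> fin_cases j <;> simp [Matrix.algebraMap_matrix_apply]⟩

end

/-! A first-order operator is written `u ∂ + (v - κ u')`. A diffeomorphism then acts on `u` as on a
density of weight `α = μ - λ - 1`, and on `v` as on a density of weight `α + 1` with the extra term
`(κ α - λ) (f''/f') f^*u`. For `α ≠ 0` the choice `κ = λ / α` removes that term and the module
splits as `F_α ⊕ F_{α+1}`. For `α = 0` the term `-λ f''/f'` does not depend on `κ`, and it vanishes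
only when `λ = 0`. A symmetry is a 2×2 block matrix, so the theorem reduces to classifying
intertwiners between densities whose weights differ by at most one.

Locality is not assumed; it is derived when the target weight `β` is nonzero
(`apply_eq_zero_of_eq_zero`). A map `f` close to the identity, supported where `φ` vanishes, fixes
`φ` but multiplies `(T φ)(0)` by `f'(0)^β ≠ 1`. Applied to a germ `x ↦ k x`, this shows that `(T
φ)(0) = 0` whenever `φ = ψ - k^(α-β) ψ(k ·)` (`apply_eq_zero_of_homological`). That equation is
solved by a geometric series, once a suitable jet of `φ` vanishes. So `T` is zero, a scalar, or of
order at most one (`eq_zero_of_lowering`, `eq_smul_id`, `raising`).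

Target weight zero needs separate arguments. Weight `0 → 0` is reduced to `0 → 1` by composing with
`D`; weights `±1 → 0` rest on the fact that `T` takes the same value on all powers `(f')^α` of
Jacobians. What survives is scalars, `D : F_0 → F_1` and the integral `F_1 → F_0`. The products of
the last two vanish, since `D 1 = 0` and `∫ φ' = 0`. A nonzero cocycle term excludes the integral
and makes the two diagonal scalars equal. -/

namespace SmoothCircle

variable {𝕜 : Type*} [RCLike 𝕜]

/-! ### Smooth periodic functions and cut-offs -/

theorem differentiable (φ : SmoothCircle 𝕜) : Differentiable ℝ φ.1 :=
  φ.2.1.differentiable (by simp)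

theorem hasDerivAt (φ : SmoothCircle 𝕜) (x : ℝ) : HasDerivAt φ.1 ((D φ).1 x) x :=
  (differentiable φ x).hasDerivAt

theorem D_eq_of_hasDerivAt {φ ψ : SmoothCircle 𝕜} (h : ∀ x, HasDerivAt φ.1 (ψ.1 x) x) : D φ = ψ :=
  Subtype.ext <| funext fun x => (h x).deriv

theorem exists_bound (φ : SmoothCircle 𝕜) : ∃ C, 0 < C ∧ ∀ x, ‖φ.1 x‖ ≤ C := by
  obtain ⟨C, hC⟩ := (φ.2.2.isBounded_of_continuous one_ne_zero φ.2.1.continuous).exists_norm_le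
  exact ⟨max C 1, by positivity, fun x => (hC _ ⟨x, rfl⟩).trans (le_max_left _ _)⟩

theorem eventually_lt_abs_sub_round {a x : ℝ} (hx : a < |x - round x|) :
    ∀ᶠ y : ℝ in nhds x, a < |y - round y| := by
  filter_upwards [Metric.ball_mem_nhds x (sub_pos.2 hx)] with y hy
  have h₁ := round_le x (round y)
  have h₂ := abs_sub_le x y (round y)
  rw [Metric.mem_ball, Real.dist_eq, abs_sub_comm] at hy
  linarith

/-- A smooth function supported in `[-a, a]`, `a < 1/2`, extended periodically. -/
noncomputable def periodize (σ : ℝ → ℝ) (hσ : ContDiff ℝ ∞ σ) {a : ℝ} (ha : a < 1 / 2)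
    (h : ∀ x, a < |x| → σ x = 0) : SmoothCircle ℝ :=
  ⟨fun x => σ (x - round x), by
    refine ⟨contDiff_iff_contDiffAt.2 fun x => ?_, fun x => by simp⟩
    -- Away from the integers the function is locally zero; near an integer `round` is locally
    -- constant. The jumps of `round` at half-integers fall in the first case because `a < 1 / 2`.
    by_cases hx : a < |x - round x|
    · have : (fun y : ℝ => σ (y - round y)) =ᶠ[nhds x] fun _ => 0 :=
        (eventually_lt_abs_sub_round hx).mono fun y hy => h _ hy
      exact contDiffAt_const.congr_of_eventuallyEq this
    · have : (fun y : ℝ => σ (y - round y)) =ᶠ[nhds x] fun y => σ (y - round x) := by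
        have hx' : |x - round x| < 1 / 2 := (not_lt.1 hx).trans_lt ha
        rw [abs_lt] at hx'
        filter_upwards [Ioo_mem_nhds (a := (round x : ℝ) - 1 / 2) (b := (round x : ℝ) + 1 / 2)
          (by linarith) (by linarith)] with y hy
        rw [round_eq_iff.2 ⟨hy.1.le, hy.2⟩]
      exact ((hσ.comp (contDiff_id.sub contDiff_const)).contDiffAt).congr_of_eventuallyEq this⟩

theorem periodize_apply_of_abs_lt (σ : ℝ → ℝ) (hσ : ContDiff ℝ ∞ σ) {a : ℝ} (ha : a < 1 / 2)
    (h : ∀ x, a < |x| → σ x = 0) {x : ℝ} (hx : |x| < 1 / 2) :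
    (periodize σ hσ ha h).1 x = σ x := by
  rw [abs_lt] at hx
  have : round x = 0 := round_eq_zero_iff.2 ⟨by linarith, by linarith⟩
  simp [periodize, this]

/-- For a smooth function on the line there is a smooth function on the circle that agrees
with it on `[-a, a]` and vanishes at distance at least `b` from the integers. -/
theorem exists_eq_near_zero (g : ℝ → ℝ) (hg : ContDiff ℝ ∞ g) {a b : ℝ} (ha : 0 < a) (hab : a < b)
    (hb : b < 1 / 2) : ∃ s : SmoothCircle ℝ, (∀ x, |x| ≤ a → s.1 x = g x) ∧
      (∀ x : ℝ, b < |x - round x| → s.1 x = 0 ∧ (D s).1 x = 0) := by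
  let χ : ContDiffBump (0 : ℝ) := ⟨a, b, ha, hab⟩
  have h0 : ∀ x, b < |x| → χ x * g x = 0 := fun x hx => by
    rw [χ.zero_of_le_dist (by simpa using hx.le), zero_mul]
  refine ⟨periodize (fun x => χ x * g x) (χ.contDiff.mul hg) hb h0, fun x hx => ?_, fun x hx => ?_⟩
  · rw [periodize_apply_of_abs_lt _ _ _ _ (by linarith),
      χ.one_of_mem_closedBall (by simpa using hx), one_mul]
  · refine ⟨h0 _ hx, ?_⟩
    have : (periodize (fun x => χ x * g x) (χ.contDiff.mul hg) hb h0).1 =ᶠ[nhds x] fun _ => 0 :=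
      (eventually_lt_abs_sub_round hx).mono fun y hy => h0 _ hy
    exact this.deriv_eq.trans (deriv_const _ _)

/-- A smooth function on the circle equal to the coordinate near `0`. -/
theorem exists_eq_id : ∃ s : SmoothCircle ℝ, (∀ x, |x| < 2 / 5 → s.1 x = x) ∧
    ∀ x, |x| < 2 / 5 → (D s).1 x = 1 := by
  obtain ⟨s, hs, -⟩ := exists_eq_near_zero id contDiff_id (a := 2 / 5) (b := 9 / 20)
    (by norm_num) (by norm_num) (by norm_num)
  refine ⟨s, fun x hx => hs x hx.le, fun x hx => ?_⟩
  have : s.1 =ᶠ[nhds x] id := by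
    filter_upwards [Ioo_mem_nhds (abs_lt.1 hx).1 (abs_lt.1 hx).2] with y hy
    exact hs y (abs_lt.2 hy).le
  exact this.deriv_eq.trans (deriv_id _)

/-- A real function regarded as a `𝕜`-valued one. -/
noncomputable def ofReal (p : SmoothCircle ℝ) : SmoothCircle 𝕜 :=
  ⟨fun x => (p.1 x : 𝕜), (RCLike.ofRealCLM (K := 𝕜)).contDiff.comp p.2.1,
    fun x => by simp only [p.2.2 x]⟩

@[simp] theorem ofReal_apply (p : SmoothCircle ℝ) (x : ℝ) :
    (ofReal p : SmoothCircle 𝕜).1 x = (p.1 x : 𝕜) := rfl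

theorem D_ofReal (p : SmoothCircle ℝ) : D (ofReal p : SmoothCircle 𝕜) = ofReal (D p) :=
  D_eq_of_hasDerivAt fun x => (RCLike.ofRealCLM (K := 𝕜)).hasFDerivAt.comp_hasDerivAt x (SmoothCircle.hasDerivAt p x)

/-- The real part of a function. -/
noncomputable def re (φ : SmoothCircle 𝕜) : SmoothCircle ℝ :=
  ⟨fun x => RCLike.re (φ.1 x), (RCLike.reCLM (K := 𝕜)).contDiff.comp φ.2.1,
    fun x => by simp only [φ.2.2 x]⟩

/-- The imaginary part of a function. -/
noncomputable def im (φ : SmoothCircle 𝕜) : SmoothCircle ℝ :=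
  ⟨fun x => RCLike.im (φ.1 x), (RCLike.imCLM (K := 𝕜)).contDiff.comp φ.2.1,
    fun x => by simp only [φ.2.2 x]⟩

theorem re_add_I_smul_im (φ : SmoothCircle 𝕜) :
    ofReal (re φ) + (RCLike.I : 𝕜) • ofReal (im φ) = φ :=
  Subtype.ext <| funext fun x => by
    have := RCLike.re_add_im (φ.1 x)
    rw [mul_comm] at this
    exact this

theorem comp_apply (f : CircleDiffeo) (φ : SmoothCircle 𝕜) (x : ℝ) :
    (comp f φ).1 x = φ.1 (f.toEquiv x) := rfl

end SmoothCircle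

/-! ### Diffeomorphisms as perturbations of the identity -/

namespace CircleDiffeo

/-- The diffeomorphism `x ↦ x + p x`, for a periodic function `p` with `p' > -1`. -/
noncomputable def ofPerturb (p : SmoothCircle ℝ) (h : ∀ x, -1 < (SmoothCircle.D p).1 x) :
    CircleDiffeo :=
  have hd : ∀ x, HasDerivAt (fun x => x + p.1 x) (1 + (SmoothCircle.D p).1 x) x := fun x =>
    (hasDerivAt_id x).add (SmoothCircle.hasDerivAt p x)
  have hs : ContDiff ℝ ∞ (fun x => x + p.1 x) := contDiff_id.add p.2.1
  have hmono : StrictMono fun x => x + p.1 x :=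
    strictMono_of_deriv_pos fun x => by rw [(hd x).deriv]; linarith [h x]
  have hsurj : Function.Surjective fun x => x + p.1 x := by
    obtain ⟨C, -, hC⟩ := SmoothCircle.exists_bound p
    have hC' : ∀ x, |p.1 x| ≤ C := hC
    refine hs.continuous.surjective ?_ ?_
    · exact Filter.tendsto_atTop_mono (fun x => add_le_add_right (abs_le.1 (hC' x)).1 x)
        (Filter.tendsto_atTop_add_const_right _ _ Filter.tendsto_id)
    · exact Filter.tendsto_atBot_mono (fun x => add_le_add_right (abs_le.1 (hC' x)).2 x)
        (Filter.tendsto_atBot_add_const_right _ _ Filter.tendsto_id)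
  let e : ℝ ≃ₜ ℝ := (hmono.orderIsoOfSurjective _ hsurj).toHomeomorph
  { toEquiv := e.toEquiv
    smooth_toFun := hs
    smooth_invFun := e.contDiff_symm_deriv (fun x => by linarith [h x]) hd hs
    deriv_pos := fun x => by
      have : deriv e.toEquiv x = _ := (hd x).deriv
      rw [this]; linarith [h x]
    map_add_one := fun x => by
      change x + 1 + p.1 (x + 1) = x + p.1 x + 1
      rw [p.2.2]; ring }

variable (p : SmoothCircle ℝ) (h : ∀ x, -1 < (SmoothCircle.D p).1 x)

@[simp] theorem deriv_ofPerturb (x : ℝ) :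
    deriv (ofPerturb p h).toEquiv x = 1 + (SmoothCircle.D p).1 x :=
  ((hasDerivAt_id x).add (SmoothCircle.hasDerivAt p x)).deriv

/-- The rotation `x ↦ x + t`. -/
noncomputable def rotation (t : ℝ) : CircleDiffeo :=
  ofPerturb (algebraMap ℝ _ t) fun x => by
    have : (SmoothCircle.D (algebraMap ℝ (SmoothCircle ℝ) t)).1 x = 0 := deriv_const x t
    rw [this]; norm_num

@[simp] theorem rotation_apply (t x : ℝ) : (rotation t).toEquiv x = x + t := rfl

@[simp] theorem deriv_rotation (t x : ℝ) : deriv (rotation t).toEquiv x = 1 := by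
  have : (rotation t).toEquiv = fun x => x + t := rfl
  simp [this]

/-- For a periodic function `p` and small `ε`, the map `x ↦ x + ε p x` is a diffeomorphism. -/
theorem exists_small (p : SmoothCircle ℝ) : ∃ ε₀ : ℝ, 0 < ε₀ ∧ ∀ ε : ℝ, |ε| < ε₀ → ∀ x,
    -1 < (SmoothCircle.D (ε • p)).1 x := by
  obtain ⟨C, h0, hC⟩ := SmoothCircle.exists_bound (SmoothCircle.D p)
  refine ⟨C⁻¹, by positivity, fun ε hε x => ?_⟩
  have : |ε * (SmoothCircle.D p).1 x| < 1 := by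
    rw [abs_mul]
    calc |ε| * |(SmoothCircle.D p).1 x| ≤ |ε| * C := by gcongr; exact hC x
      _ < C⁻¹ * C := by gcongr
      _ = 1 := inv_mul_cancel₀ h0.ne'
  rw [map_smul]
  exact (abs_lt.1 this).1

end CircleDiffeo

/-! ### Pull-backs and powers of the Jacobian -/

namespace Density

open SmoothCircle

variable {𝕜 : Type*} [RCLike 𝕜]

theorem pullback_eq (α : 𝕜) (f : CircleDiffeo) (φ : SmoothCircle 𝕜) :
    pullback α f φ = f.derivPow α * comp f φ := rfl

theorem pullback_apply (α : 𝕜) (f : CircleDiffeo) (φ : SmoothCircle 𝕜) (x : ℝ) :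
    (pullback α f φ).1 x =
      NormedSpace.exp (Real.log (deriv f.toEquiv x) • α) * φ.1 (f.toEquiv x) := rfl

theorem pullback_rotation_apply (α : 𝕜) (t : ℝ) (φ : SmoothCircle 𝕜) (x : ℝ) :
    (pullback α (CircleDiffeo.rotation t) φ).1 x = φ.1 (x + t) := by
  simp [pullback_apply]

end Density

namespace CircleDiffeo

open SmoothCircle

variable {𝕜 : Type*} [RCLike 𝕜]

theorem derivPow_apply (f : CircleDiffeo) (α : 𝕜) (x : ℝ) :
    (f.derivPow α).1 x = NormedSpace.exp (Real.log (deriv f.toEquiv x) • α) := rfl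

theorem derivPow_zero (f : CircleDiffeo) : f.derivPow (0 : 𝕜) = 1 :=
  Subtype.ext <| funext fun x => by simp [derivPow_apply]

theorem exp_add (a b : 𝕜) :
    NormedSpace.exp (a + b) = NormedSpace.exp a * NormedSpace.exp b :=
  letI := NormedAlgebra.restrictScalars ℚ ℝ 𝕜
  NormedSpace.exp_add

theorem derivPow_add (f : CircleDiffeo) (α β : 𝕜) :
    f.derivPow (α + β) = f.derivPow α * f.derivPow β :=
  Subtype.ext <| funext fun x => by
    rw [derivPow_apply, smul_add, exp_add]; rfl

theorem exp_real_smul_one (t : ℝ) : NormedSpace.exp (t • (1 : 𝕜)) = ((Real.exp t : ℝ) : 𝕜) := by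
  have h := NormedSpace.algebraMap_exp_comm (𝔸 := 𝕜) t
  rw [Algebra.algebraMap_eq_smul_one t] at h
  rw [← h, Real.exp_eq_exp_ℝ]

theorem derivPow_one_apply (f : CircleDiffeo) (x : ℝ) :
    (f.derivPow (1 : 𝕜)).1 x = ((deriv f.toEquiv x : ℝ) : 𝕜) := by
  rw [derivPow_apply, exp_real_smul_one, Real.exp_log (f.deriv_pos x)]

/-- The logarithmic derivative `f'' / f'` of the Jacobian. -/
noncomputable def logDeriv (f : CircleDiffeo) : SmoothCircle 𝕜 :=
  ofReal (D ⟨fun x => Real.log (deriv f.toEquiv x),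
    f.contDiff_deriv.log fun x => (f.deriv_pos x).ne', fun x => by simp only [f.periodic_deriv x]⟩)

theorem D_derivPow (f : CircleDiffeo) (α : 𝕜) :
    D (f.derivPow α) = α • (f.logDeriv * f.derivPow α) := by
  refine D_eq_of_hasDerivAt fun x => ?_
  let l : SmoothCircle ℝ := ⟨fun x => Real.log (deriv f.toEquiv x),
    f.contDiff_deriv.log fun x => (f.deriv_pos x).ne', fun x => by simp only [f.periodic_deriv x]⟩
  have h := (hasDerivAt_exp_smul_const (𝕂 := ℝ) α (l.1 x)).scomp x (SmoothCircle.hasDerivAt l x)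
  refine h.congr_deriv ?_
  rw [RCLike.real_smul_eq_coe_mul]
  change _ = α * (((D l).1 x : 𝕜) * NormedSpace.exp (l.1 x • α))
  ring

theorem logDeriv_apply (f : CircleDiffeo) (x : ℝ) : (f.logDeriv : SmoothCircle 𝕜).1 x =
    ((deriv (deriv f.toEquiv) x / deriv f.toEquiv x : ℝ) : 𝕜) := by
  have h : HasDerivAt (deriv f.toEquiv) (deriv (deriv f.toEquiv) x) x :=
    (f.contDiff_deriv.differentiable (by simp) x).hasDerivAt
  exact congrArg _ (h.log (f.deriv_pos x).ne').deriv

end CircleDiffeo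

/-! ### The homological equation of a linear contraction -/

namespace SmoothCircle

variable {𝕜 : Type*} [RCLike 𝕜]

/-- A smooth function on the line has a smooth primitive. -/
theorem exists_primitive (g : ℝ → 𝕜) (hg : ContDiff ℝ ∞ g) :
    ∃ G : ℝ → 𝕜, ContDiff ℝ ∞ G ∧ (∀ x, HasDerivAt G (g x) x) ∧ G 0 = 0 := by
  have h : ∀ x, HasDerivAt (fun u => ∫ t in (0 : ℝ)..u, g t) (g x) x := fun x =>
    (hg.continuous.integral_hasStrictDerivAt 0 x).hasDerivAt
  refine ⟨_, contDiff_infty_iff_deriv.2 ⟨fun x => (h x).differentiableAt, ?_⟩, h, by simp⟩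
  rwa [funext fun x => (h x).deriv]

theorem iteratedDeriv_bound (φ : SmoothCircle 𝕜) (n : ℕ) :
    ∃ C, 0 < C ∧ ∀ x, ‖iteratedDeriv n φ.1 x‖ ≤ C := by
  have : ∀ φ : SmoothCircle 𝕜, iteratedDeriv n φ.1 = ((D ^ n) φ).1 := by
    induction n with
    | zero => intro φ; simp
    | succ n ih => intro φ; rw [iteratedDeriv_succ', pow_succ]; exact ih (D φ)
  rw [this]
  exact exists_bound _

/-- The homological equation `ψ x - k ψ (k x) = φ x` for a contraction `x ↦ k x`. -/
theorem exists_sub_mul_comp_eq (φ : SmoothCircle 𝕜) {k : ℝ} (h0 : 0 < k) (h1 : k < 1) :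
    ∃ ψ : ℝ → 𝕜, ContDiff ℝ ∞ ψ ∧ ∀ x, ψ x - k * ψ (k * x) = φ.1 x := by
  choose C hC0 hC using iteratedDeriv_bound φ
  have hk : Summable fun n : ℕ => k ^ n := summable_geometric_of_lt_one h0.le h1
  -- Each derivative of `φ (k ^ n * x)` brings a further factor `k ^ n ≤ 1`, so the prefactor `k ^
  -- n` alone makes the series of derivatives of every order summable.
  have hbound : ∀ (j n : ℕ) (x : ℝ),
      ‖iteratedFDeriv ℝ j (fun x => k ^ n • φ.1 (k ^ n * x)) x‖ ≤ C j * k ^ n := by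
    intro j n x
    have e : (fun x => k ^ n • φ.1 (k ^ n * x)) = k ^ n • fun x => φ.1 (k ^ n * x) := rfl
    have hj : ContDiff ℝ j φ.1 := φ.2.1.of_le (mod_cast le_top)
    have hj' : ContDiff ℝ j fun x => φ.1 (k ^ n * x) := hj.comp (contDiff_const.mul contDiff_id)
    rw [norm_iteratedFDeriv_eq_norm_iteratedDeriv, e, iteratedDeriv_const_smul
      hj'.contDiffAt, iteratedDeriv_comp_const_smul hj, norm_smul, norm_smul, mul_comm (C j)]
    have h₂ : ‖(k ^ n) ^ j‖ ≤ 1 := by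
      rw [Real.norm_of_nonneg (by positivity)]
      exact pow_le_one₀ (by positivity) (pow_le_one₀ h0.le h1.le)
    rw [Real.norm_of_nonneg (by positivity)]
    gcongr
    calc _ ≤ 1 * C j := by gcongr; exact hC _ _
      _ = C j := one_mul _
  refine ⟨fun x => ∑' n : ℕ, k ^ n • φ.1 (k ^ n * x), ?_, fun x => ?_⟩
  · exact contDiff_tsum (v := fun j n => C j * k ^ n)
      (fun n => (φ.2.1.comp (contDiff_const.mul contDiff_id)).const_smul (k ^ n))
      (fun j _ => hk.mul_left _) (fun j n x _ => hbound j n x)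
  · have hs : ∀ x, Summable fun n : ℕ => k ^ n • φ.1 (k ^ n * x) := fun x =>
      Summable.of_norm_bounded (hk.mul_left (C 0)) fun n => by simpa using hbound 0 n x
    beta_reduce
    rw [(hs x).tsum_eq_zero_add, ← tsum_mul_left]
    simp only [pow_zero, one_smul, one_mul, pow_succ, mul_assoc, RCLike.real_smul_eq_coe_mul]
    push_cast
    simp only [mul_left_comm, mul_assoc]
    rw [add_sub_cancel_right]

/-- Integrating the homological equation raises its eigenvalue. -/
theorem exists_sub_mul_comp_eq_of_D (φ : SmoothCircle 𝕜) (h : φ.1 0 = 0) (k : ℝ) (c : 𝕜)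
    (hD : ∃ ψ : ℝ → 𝕜, ContDiff ℝ ∞ ψ ∧ ∀ x, ψ x - c * k * ψ (k * x) = (D φ).1 x) :
    ∃ ψ : ℝ → 𝕜, ContDiff ℝ ∞ ψ ∧ ∀ x, ψ x - c * ψ (k * x) = φ.1 x := by
  obtain ⟨ψ, hψ, hk⟩ := hD
  obtain ⟨Ψ, hΨ, hd, h0⟩ := exists_primitive ψ hψ
  refine ⟨Ψ, hΨ, fun x => ?_⟩
  -- Differentiating the desired equation turns `c` into `c * k`, which is the equation solved by
  -- `ψ`. The constant of integration is zero because `Ψ` and `φ` vanish at `0`.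
  have key : ∀ x, HasDerivAt (fun x => Ψ x - c * Ψ (k * x) - φ.1 x) 0 x := fun x => by
    have h₁ := ((hd (k * x)).scomp x ((hasDerivAt_id x).const_mul k)).const_mul c
    refine (((hd x).sub h₁).sub (hasDerivAt φ x)).congr_deriv ?_
    rw [← hk x, RCLike.real_smul_eq_coe_mul]
    push_cast
    ring
  have := is_const_of_deriv_eq_zero (fun x => (key x).differentiableAt) (fun x => (key x).deriv) x 0
  simpa [h0, h, sub_eq_zero] using this

end SmoothCircle

/-- Intertwining operators `F_α → F_β` of the actions of diffeomorphisms. -/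
def Equivariant {𝕜 : Type*} [RCLike 𝕜] (α β : 𝕜) (T : SmoothCircle 𝕜 →ₗ[𝕜] SmoothCircle 𝕜) :
    Prop :=
  ∀ (f : CircleDiffeo) (φ : SmoothCircle 𝕜),
    T (Density.pullback α f φ) = Density.pullback β f (T φ)

/-! ### Locality and coboundaries -/

namespace Equivariant

open SmoothCircle Density

variable {𝕜 : Type*} [RCLike 𝕜] {α β : 𝕜} {T : SmoothCircle 𝕜 →ₗ[𝕜] SmoothCircle 𝕜}

/-- The derivative of `(1 + t)^β` at `t = 0` is `β ≠ 0`. Only small `t` can be claimed, since for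
imaginary `β` the value `1` is taken again elsewhere. -/
theorem eventually_exp_log_ne (hβ : β ≠ 0) :
    ∀ᶠ t : ℝ in nhdsWithin 0 {0}ᶜ, NormedSpace.exp (Real.log (1 + t) • β) ≠ 1 := by
  have h₁ : HasDerivAt (fun t : ℝ => Real.log (1 + t)) 1 0 := by
    have := ((hasDerivAt_id (0 : ℝ)).const_add 1).log (by simp)
    simpa using this
  have h₂ := (hasDerivAt_exp_smul_const (𝕂 := ℝ) β 0).scomp_of_eq 0 h₁ (by simp)
  refine HasDerivAt.eventually_ne h₂ ?_
  simpa using hβ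

/-- A diffeomorphism fixing `0`, supported where `φ` vanishes and with `f'(0) = 1 + ε`, fixes `φ`;
hence `(T φ)(0) = (1 + ε)^β (T φ)(0)`, and the factor differs from `1`. -/
theorem apply_eq_zero_of_eq_zero (hT : Equivariant α β T) (hβ : β ≠ 0) {φ : SmoothCircle 𝕜} {r : ℝ}
    (hr : 0 < r) (h : ∀ x, |x| < r → φ.1 x = 0) : (T φ).1 0 = 0 := by
  wlog hr' : r < 1 / 2 generalizing r
  · exact this (r := 1 / 4) (by norm_num) (fun x hx => h x (by linarith)) (by norm_num)
  obtain ⟨p, hp, hp0⟩ := exists_eq_near_zero id contDiff_id (a := r / 4) (b := r / 2)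
    (by linarith) (by linarith) (by linarith)
  obtain ⟨C, hC0, hC⟩ := exists_bound p
  obtain ⟨ε₀, hε₀, hε⟩ := CircleDiffeo.exists_small p
  have hlt : 0 < min ε₀ (r / 2 / C) := lt_min hε₀ (by positivity)
  obtain ⟨ε, hne, hε1⟩ := ((eventually_exp_log_ne hβ).filter_mono
    (nhdsWithin_mono 0 fun x (hx : x ∈ Set.Ioi (0 : ℝ)) => (ne_of_gt hx : x ≠ 0))).and (Ioo_mem_nhdsGT hlt) |>.exists
  have hφ : ∀ x : ℝ, |x - round x| < r → φ.1 x = 0 := fun x hx => by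
    have := φ.2.2.sub_zsmul_eq (round x) (x := x)
    rw [← this]
    exact h _ (by simpa using hx)
  let f := CircleDiffeo.ofPerturb (ε • p) (hε ε (by rw [abs_of_pos hε1.1]; exact hε1.2.trans_le (min_le_left _ _)))
  have hf : ∀ x, f.toEquiv x = x + ε * p.1 x := fun x => rfl
  have hf' : ∀ x, deriv f.toEquiv x = 1 + ε * (D p).1 x := fun x => by
    rw [CircleDiffeo.deriv_ofPerturb, map_smul]; rfl
  -- Where `p` vanishes with its derivative, `f` acts trivially. Elsewhere `x` lies within `r / 2`
  -- of an integer and moves by less than `r / 2`, so `φ` is zero both at `x` and at its image.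
  have hfix : pullback α f φ = φ := Subtype.ext <| funext fun x => by
    rw [pullback_apply, hf, hf']
    rcases lt_or_ge (r / 2) |x - round x| with hx | hx
    · rw [(hp0 x hx).1, (hp0 x hx).2]
      simp
    · rw [hφ x (by linarith)]
      have h₁ : |ε * p.1 x| < r / 2 := by
        rw [abs_mul, abs_of_pos hε1.1]
        calc ε * |p.1 x| ≤ ε * C := by gcongr; exacts [hε1.1.le, hC x]
          _ < r / 2 / C * C := by gcongr; exact hε1.2.trans_le (min_le_right _ _)
          _ = r / 2 := by field_simp
      rw [hφ _ ?_, mul_zero]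
      refine (round_le _ (round x)).trans_lt ?_
      have := abs_add_le (x - round x) (ε * p.1 x)
      rw [sub_add_eq_add_sub] at this
      linarith
  have h0 : p.1 0 = 0 := by simpa using hp 0 (by simp; linarith)
  have hp' : (D p).1 0 = 1 := by
    have : p.1 =ᶠ[nhds 0] id := by
      filter_upwards [Ioo_mem_nhds (show -(r / 4) < 0 by linarith) (show 0 < r / 4 by linarith)]
        with y hy
      exact hp y (abs_lt.2 hy).le
    exact this.deriv_eq.trans (deriv_id _)
  have key := congrArg (fun φ : SmoothCircle 𝕜 => φ.1 0) (hT f φ)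
  simp only [hfix, pullback_apply, hf, hf', h0, hp', mul_zero, mul_one, add_zero] at key
  by_contra hne0
  exact hne (mul_right_cancel₀ hne0 (by rw [← key, one_mul]))

/-- Rotations reduce every question about `T φ` to its value at `0`. -/
theorem apply_rotate (hT : Equivariant α β T) (φ : SmoothCircle 𝕜) (x : ℝ) :
    (T φ).1 x = (T (pullback α (CircleDiffeo.rotation x) φ)).1 0 := by
  rw [hT, pullback_rotation_apply, zero_add]

/-- An equivariant map kills at `0` the coboundaries of a germ of contraction. -/
theorem apply_eq_zero_of_homological (hT : Equivariant α β T) (hβ : β ≠ 0) : ∃ k₀ : ℝ, k₀ < 1 ∧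
    ∀ k : ℝ, 0 < k → k₀ < k → k < 1 → ∀ (φ : SmoothCircle 𝕜) (ψ : ℝ → 𝕜), ContDiff ℝ ∞ ψ →
      (∀ x, ψ x - NormedSpace.exp (Real.log k • (α - β)) * ψ (k * x) = φ.1 x) → (T φ).1 0 = 0 := by
  obtain ⟨s, hs, hs'⟩ := exists_eq_id
  obtain ⟨ε₀, hε₀, hε⟩ := CircleDiffeo.exists_small s
  refine ⟨1 - ε₀, by linarith, fun k h0 hk0 hk1 φ ψ hψ h => ?_⟩
  let f := CircleDiffeo.ofPerturb ((k - 1) • s) (hε (k - 1) (by rw [abs_lt]; constructor <;> linarith))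
  have hf : ∀ x, f.toEquiv x = x + (k - 1) * s.1 x := fun x => rfl
  have hf' : ∀ x, deriv f.toEquiv x = 1 + (k - 1) * (D s).1 x := fun x => by
    rw [CircleDiffeo.deriv_ofPerturb, map_smul]; rfl
  -- The solution `ψ` lives on the line and need not be periodic; `ψ ∘ s` is periodic and has the
  -- same germ at `0`.
  let Ψ : SmoothCircle 𝕜 := ⟨fun x => ψ (s.1 x), hψ.comp s.2.1, fun x => by simp only [s.2.2 x]⟩
  -- The factor `k^(-β)` cancels the `k^β` by which `f` acts at its fixed point `0` on densities of
  -- weight `β`, so the two terms in `T Ψ` cancel there.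
  let c : 𝕜 := NormedSpace.exp (Real.log k • (-β))
  have hloc : (T (φ - Ψ + c • pullback α f Ψ)).1 0 = 0 := by
    refine hT.apply_eq_zero_of_eq_zero hβ (r := 2 / 5) (by norm_num) fun x hx => ?_
    have hkx : |k * x| < 2 / 5 := by
      rw [abs_mul, abs_of_pos h0]
      nlinarith [abs_nonneg x]
    have e₁ : x + (k - 1) * x = k * x := by ring
    have e₂ : (1 : ℝ) + (k - 1) * 1 = k := by ring
    change φ.1 x - ψ (s.1 x) + c * ((pullback α f Ψ).1 x) = 0
    rw [pullback_apply, hf, hf', hs x hx, hs' x hx, e₁, e₂, ← h x]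
    change _ + _ * (_ * ψ (s.1 (k * x))) = 0
    rw [hs _ hkx, ← mul_assoc, ← CircleDiffeo.exp_add, ← smul_add, neg_add_eq_sub]
    ring
  have e : (pullback β f (T Ψ)).1 0 = NormedSpace.exp (Real.log k • β) * (T Ψ).1 0 := by
    rw [pullback_apply, hf, hf', hs 0 (by norm_num), hs' 0 (by norm_num)]
    simp
  rw [map_add, map_sub, map_smul, hT] at hloc
  change (T φ).1 0 - (T Ψ).1 0 + c * (pullback β f (T Ψ)).1 0 = 0 at hloc
  rw [e, ← mul_assoc, ← CircleDiffeo.exp_add, ← smul_add, neg_add_cancel] at hloc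
  simpa using hloc

end Equivariant

/-! ### Differentiation and integration of densities -/

namespace SmoothCircle

open Density

variable {𝕜 : Type*} [RCLike 𝕜]

theorem coe_one_apply (x : ℝ) : (1 : SmoothCircle 𝕜).1 x = 1 := rfl

theorem coe_add_apply (φ ψ : SmoothCircle 𝕜) (x : ℝ) : (φ + ψ).1 x = φ.1 x + ψ.1 x := rfl

theorem coe_sub_apply (φ ψ : SmoothCircle 𝕜) (x : ℝ) : (φ - ψ).1 x = φ.1 x - ψ.1 x := rfl

theorem coe_mul_apply (φ ψ : SmoothCircle 𝕜) (x : ℝ) : (φ * ψ).1 x = φ.1 x * ψ.1 x := rfl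

theorem coe_smul_apply (c : 𝕜) (φ : SmoothCircle 𝕜) (x : ℝ) : (c • φ).1 x = c * φ.1 x := rfl

theorem ext {φ ψ : SmoothCircle 𝕜} (h : ∀ x, φ.1 x = ψ.1 x) : φ = ψ :=
  Subtype.ext (funext h)

theorem D_one : D (1 : SmoothCircle 𝕜) = 0 :=
  D_eq_of_hasDerivAt fun x => hasDerivAt_const x _

theorem eq_smul_one_of_D_eq_zero {φ : SmoothCircle 𝕜} (h : D φ = 0) : φ = φ.1 0 • 1 :=
  ext fun x => by
    have := is_const_of_deriv_eq_zero (differentiable φ) (fun x => congrFun (congrArg Subtype.val h) x) x 0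
    simpa [coe_smul_apply, coe_one_apply] using this

theorem D_comp_eq (f : CircleDiffeo) (φ : SmoothCircle 𝕜) :
    D (comp f φ) = f.derivPow 1 * comp f (D φ) :=
  D_eq_of_hasDerivAt fun x => by
    have h₁ := (f.smooth_toFun.differentiable (by simp) x).hasDerivAt
    refine ((hasDerivAt φ (f.toEquiv x)).scomp x h₁).congr_deriv ?_
    rw [RCLike.real_smul_eq_coe_mul, coe_mul_apply, f.derivPow_one_apply]
    rfl

theorem D_pullback (α : 𝕜) (f : CircleDiffeo) (φ : SmoothCircle 𝕜) :
    D (pullback α f φ) =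
      pullback (α + 1) f (D φ) + α • (f.logDeriv * pullback α f φ) := by
  simp only [pullback_eq, D_mul, D_comp_eq, f.D_derivPow, f.derivPow_add, smul_mul_assoc]
  rw [add_comm]
  simp only [mul_assoc]

theorem pullback_one (α : 𝕜) (f : CircleDiffeo) : pullback α f 1 = f.derivPow α := by
  rw [pullback_eq, map_one, mul_one]

theorem pullback_rotation_D (α β : 𝕜) (t : ℝ) (φ : SmoothCircle 𝕜) :
    D (pullback α (CircleDiffeo.rotation t) φ) = pullback β (CircleDiffeo.rotation t) (D φ) :=
  D_eq_of_hasDerivAt fun x => by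
    have : (pullback α (CircleDiffeo.rotation t) φ).1 = fun x => φ.1 (x + t) :=
      funext fun x => pullback_rotation_apply α t φ x
    rw [this, pullback_rotation_apply]
    exact (hasDerivAt φ (x + t)).comp_add_const x t

/-! ### The mean value -/

/-- The mean value `∫ φ dx` over the circle. -/
noncomputable def mean : SmoothCircle 𝕜 →ₗ[𝕜] 𝕜 where
  toFun φ := ∫ x in (0 : ℝ)..1, φ.1 x
  map_add' φ ψ := intervalIntegral.integral_add (φ.2.1.continuous.intervalIntegrable _ _)
    (ψ.2.1.continuous.intervalIntegrable _ _)
  map_smul' c φ := intervalIntegral.integral_smul c φ.1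

theorem mean_one : mean (1 : SmoothCircle 𝕜) = 1 := by
  change ∫ x in (0 : ℝ)..1, (1 : 𝕜) = 1
  simp

theorem mean_D (φ : SmoothCircle 𝕜) : mean (D φ) = 0 := by
  change ∫ x in (0 : ℝ)..1, deriv φ.1 x = 0
  rw [intervalIntegral.integral_deriv_eq_sub (fun x _ => differentiable φ x)
    ((D φ).2.1.continuous.intervalIntegrable _ _)]
  have := φ.2.2 0
  rw [zero_add] at this
  rw [this, sub_self]

theorem exists_eq_mean_add_D (φ : SmoothCircle 𝕜) : ∃ ψ, φ = mean φ • 1 + D ψ := by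
  obtain ⟨G, hG, hd, h0⟩ := exists_primitive (φ - mean φ • 1).1 (φ - mean φ • 1).2.1
  have hper : Function.Periodic G 1 := fun x => by
    have hd' : ∀ x, HasDerivAt (fun x => G (x + 1) - G x) 0 x := fun x => by
      refine (((hd (x + 1)).comp_add_const x 1).sub (hd x)).congr_deriv ?_
      rw [(φ - mean φ • 1).2.2 x, sub_self]
    have h₁ := is_const_of_deriv_eq_zero (fun x => (hd' x).differentiableAt)
      (fun x => (hd' x).deriv) x 0
    have h₂ : ∫ x in (0 : ℝ)..1, (φ - mean φ • 1).1 x = G 1 - G 0 :=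
      intervalIntegral.integral_eq_sub_of_hasDerivAt (fun x _ => hd x)
        ((φ - mean φ • 1).2.1.continuous.intervalIntegrable _ _)
    have h₃ : mean (φ - mean φ • 1) = 0 := by
      rw [map_sub, map_smul, mean_one, smul_eq_mul, mul_one, sub_self]
    rw [show ∫ x in (0 : ℝ)..1, (φ - mean φ • 1).1 x = 0 from h₃] at h₂
    rw [zero_add, ← h₂] at h₁
    exact sub_eq_zero.1 h₁
  refine ⟨⟨G, hG, hper⟩, ?_⟩
  rw [D_eq_of_hasDerivAt (ψ := φ - mean φ • 1) hd]
  abel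

theorem mean_pullback_one (f : CircleDiffeo) (φ : SmoothCircle 𝕜) :
    mean (pullback 1 f φ) = mean φ := by
  obtain ⟨ψ, hψ⟩ := exists_eq_mean_add_D φ
  have h₁ : ∀ ψ : SmoothCircle 𝕜, pullback 1 f (D ψ) = D (comp f ψ) := fun ψ => (D_comp_eq f ψ).symm
  have h₂ : mean (f.derivPow (1 : 𝕜)) = 1 := by
    change ∫ x in (0 : ℝ)..1, (f.derivPow (1 : 𝕜)).1 x = 1
    rw [intervalIntegral.integral_eq_sub_of_hasDerivAt (f := fun x => (f.toEquiv x : 𝕜))]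
    · have := f.map_add_one 0
      rw [zero_add] at this
      rw [this]
      push_cast
      ring
    · intro x _
      rw [f.derivPow_one_apply]
      exact (RCLike.ofRealCLM (K := 𝕜)).hasFDerivAt.comp_hasDerivAt x
        (f.smooth_toFun.differentiable (by simp) x).hasDerivAt
    · exact (f.derivPow (1 : 𝕜)).2.1.continuous.intervalIntegrable _ _
  conv_lhs => rw [hψ]
  rw [map_add, map_smul, h₁, map_add, map_smul, mean_D, pullback_one, h₂]
  simp

/-! ### Trigonometric perturbations of the identity -/

/-- The function `sin (2πnx) / (2πn)`. -/
noncomputable def sine (n : ℕ) : SmoothCircle ℝ :=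
  ⟨fun x => Real.sin (2 * Real.pi * n * x) / (2 * Real.pi * n), by fun_prop, fun x => by
    have : 2 * Real.pi * n * (x + 1) = 2 * Real.pi * n * x + n * (2 * Real.pi) := by ring
    beta_reduce
    rw [this, Real.sin_add_nat_mul_two_pi]⟩

theorem D_sine {n : ℕ} (hn : n ≠ 0) (x : ℝ) :
    (D (sine n)).1 x = Real.cos (2 * Real.pi * n * x) := by
  have h := (((hasDerivAt_id x).const_mul (2 * Real.pi * n)).sin.div_const
    (2 * Real.pi * n)).deriv
  refine h.trans ?_
  have : (n : ℝ) ≠ 0 := by exact_mod_cast hn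
  simp only [id]
  field_simp

end SmoothCircle

namespace CircleDiffeo

open SmoothCircle

variable {𝕜 : Type*} [RCLike 𝕜]

theorem exists_wave {n : ℕ} (hn : n ≠ 0) {ε : ℝ} (hε : |ε| < 1) : ∃ f : CircleDiffeo,
    ∀ x, deriv f.toEquiv x = 1 + ε * Real.cos (2 * Real.pi * n * x) := by
  refine ⟨ofPerturb (ε • sine n) fun x => ?_, fun x => ?_⟩
  · have h : (D (ε • sine n)).1 x = ε * Real.cos (2 * Real.pi * n * x) := by
      rw [map_smul, ← D_sine hn]; rfl
    rw [h]
    have h₁ : |ε * Real.cos (2 * Real.pi * n * x)| < 1 := by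
      rw [abs_mul]
      nlinarith [Real.abs_cos_le_one (2 * Real.pi * n * x), abs_nonneg ε,
        abs_nonneg (Real.cos (2 * Real.pi * n * x))]
    exact (abs_lt.1 h₁).1
  · rw [deriv_ofPerturb, map_smul, ← D_sine hn]; rfl

theorem logDeriv_wave {f : CircleDiffeo} {ε : ℝ}
    (hf : ∀ x, deriv f.toEquiv x = 1 + ε * Real.cos (2 * Real.pi * x)) (x : ℝ) :
    (f.logDeriv : SmoothCircle 𝕜).1 x =
      ((-(2 * Real.pi * ε * Real.sin (2 * Real.pi * x)) / deriv f.toEquiv x : ℝ) : 𝕜) := by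
  have h : HasDerivAt (deriv f.toEquiv) (-(2 * Real.pi * ε * Real.sin (2 * Real.pi * x))) x := by
    rw [funext hf]
    refine ((((hasDerivAt_id x).const_mul (2 * Real.pi)).cos.const_mul ε).const_add 1).congr_deriv ?_
    simp only [id]
    ring
  rw [logDeriv_apply, h.deriv]

/-- Some diffeomorphism has a point where the Jacobian is stationary and different from `1`,
and another one where the Jacobian is `1` and not stationary. -/
theorem exists_logDeriv_ne : ∃ (f : CircleDiffeo) (x y : ℝ),
    deriv f.toEquiv x ≠ 1 ∧ (f.logDeriv : SmoothCircle 𝕜).1 x = 0 ∧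
    deriv f.toEquiv y = 1 ∧ (f.logDeriv : SmoothCircle 𝕜).1 y ≠ 0 := by
  obtain ⟨f, hf⟩ := exists_wave one_ne_zero (ε := 1 / 2) (by rw [abs_of_pos] <;> norm_num)
  simp only [Nat.cast_one, mul_one] at hf
  have e : 2 * Real.pi * (1 / 4) = Real.pi / 2 := by ring
  refine ⟨f, 0, 1 / 4, ?_, ?_, ?_, ?_⟩
  · rw [hf]; norm_num
  · rw [logDeriv_wave hf]; simp
  · rw [hf, e]; simp
  · rw [logDeriv_wave hf, hf, e]; simp [Real.pi_ne_zero]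

end CircleDiffeo

/-! ### Invariant functionals on functions -/

namespace SmoothCircle

open CircleDiffeo

variable {𝕜 : Type*} [RCLike 𝕜]

/-- A linear map killing the real functions is zero. -/
theorem linearMap_eq_zero {M : Type*} [AddCommGroup M] [Module 𝕜 M] {ℓ : SmoothCircle 𝕜 →ₗ[𝕜] M}
    (h : ∀ p : SmoothCircle ℝ, ℓ (ofReal p) = 0) : ℓ = 0 :=
  LinearMap.ext fun φ => by
    rw [← re_add_I_smul_im φ, map_add, map_smul, h, h]
    simp

/-- There is no nonzero invariant linear functional on functions. -/
theorem invariant_functional_eq_zero {ℓ : SmoothCircle 𝕜 →ₗ[𝕜] 𝕜}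
    (hℓ : ∀ (f : CircleDiffeo) (φ : SmoothCircle 𝕜), ℓ (comp f φ) = ℓ φ) : ℓ = 0 := by
  have key : ∀ p : SmoothCircle ℝ, (∀ x : ℝ, 3 / 10 < |x - round x| → p.1 x = 0) →
      ℓ (ofReal p) = 0 := by
    intro p hp
    obtain ⟨s, hs, -⟩ := exists_eq_id
    obtain ⟨C, hC0, hC⟩ := exists_bound p
    obtain ⟨ε₀, hε₀, hε⟩ := exists_small p
    obtain ⟨ε, hε0, hε1⟩ := exists_between (lt_min hε₀ (show 0 < 1 / 10 / C by positivity))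
    let f := ofPerturb (ε • p) (hε ε (by rw [abs_of_pos hε0]; exact hε1.trans_le (min_le_left _ _)))
    -- On the support of `p`, within `3/10` of the integers, `s` is the coordinate up to an integer
    -- shift. A displacement below `1/10` stays in the range `2/5` where this holds, so moving by `ε
    -- p` adds exactly `ε p` to `s`, and invariance forces `ℓ p = 0`.
    have h₁ : comp f (ofReal s : SmoothCircle 𝕜) = ofReal s + (ε : 𝕜) • ofReal p :=
      ext fun x => by
        have : s.1 (x + ε * p.1 x) = s.1 x + ε * p.1 x := by
          rcases lt_or_ge (3 / 10) |x - round x| with hx | hx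
          · simp [hp x hx]
          · have h₁ : |ε * p.1 x| < 1 / 10 := by
              rw [abs_mul, abs_of_pos hε0]
              calc ε * |p.1 x| ≤ ε * C := by gcongr; exact hC x
                _ < 1 / 10 / C * C := by gcongr; exact hε1.trans_le (min_le_right _ _)
                _ = 1 / 10 := by field_simp
            have h₂ := abs_add_le (x - round x) (ε * p.1 x)
            have h₃ : ∀ y, s.1 (y - round x) = s.1 y := fun y => by
              simpa using s.2.2.sub_zsmul_eq (round x) (x := y)
            rw [← h₃ x, ← h₃ (x + _), add_sub_right_comm, hs _ (by linarith), hs _ (by linarith)]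
        change ((s.1 (x + ε * p.1 x) : ℝ) : 𝕜) = s.1 x + ε * p.1 x
        rw [this]
        push_cast
        rfl
    have h₂ := hℓ f (ofReal s)
    rw [h₁, map_add, map_smul, add_eq_left, smul_eq_mul] at h₂
    exact (mul_eq_zero.1 h₂).resolve_left (by exact_mod_cast hε0.ne')
  obtain ⟨χ, h1, h0⟩ := exists_eq_near_zero (fun _ => 1) contDiff_const (a := 1 / 5) (b := 3 / 10)
    (by norm_num) (by norm_num) (by norm_num)
  refine linearMap_eq_zero fun p => ?_
  have e : (ofReal p : SmoothCircle 𝕜) = ofReal (χ * p) + ofReal ((1 - χ) * p) := ext fun x => by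
    rw [coe_add_apply, ofReal_apply, ofReal_apply, ofReal_apply, coe_mul_apply, coe_mul_apply, coe_sub_apply]
    rw [← RCLike.ofReal_add, coe_one_apply]
    congr 1
    ring
  -- The piece `(1 - χ) p` vanishes within `1/5` of the integers; a half-turn puts its support
  -- within `1/2 - 1/5 = 3/10` of them, where `key` applies.
  have e' : comp (rotation (1 / 2)) (ofReal ((1 - χ) * p) : SmoothCircle 𝕜) =
      ofReal (comp (rotation (1 / 2)) ((1 - χ) * p)) := rfl
  rw [e, map_add, key _ fun x hx => by rw [coe_mul_apply, (h0 x hx).1, zero_mul],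
    ← hℓ (rotation (1 / 2)), e', key _ fun x hx => ?_, add_zero]
  have h₃ : ∀ (y : ℝ) (n : ℤ), χ.1 (y - n) = χ.1 y := fun y n => by
    simpa using χ.2.2.sub_zsmul_eq n (x := y)
  have h₄ : χ.1 (x + 1 / 2) = 1 := by
    have h₅ := abs_sub_round x
    rcases abs_cases (x - round x) with ⟨h₆, -⟩ | ⟨h₆, -⟩
    · rw [← h₃ _ (round x + 1), h1]
      push_cast
      rw [abs_le]
      constructor <;> linarith
    · rw [← h₃ _ (round x), h1]
      rw [abs_le]
      constructor <;> linarith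
  rw [comp_apply, CircleDiffeo.rotation_apply, coe_mul_apply, coe_sub_apply, h₄, coe_one_apply, sub_self, zero_mul]

end SmoothCircle

/-! ### Classification of intertwiners between densities -/

namespace Equivariant

open SmoothCircle Density CircleDiffeo

variable {𝕜 : Type*} [RCLike 𝕜] {α β : 𝕜} {T : SmoothCircle 𝕜 →ₗ[𝕜] SmoothCircle 𝕜}

theorem map_one_eq (hT : Equivariant α β T) : T 1 = (T 1).1 0 • 1 :=
  SmoothCircle.ext fun x => by
    have : pullback α (CircleDiffeo.rotation x) (1 : SmoothCircle 𝕜) = 1 :=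
      SmoothCircle.ext fun y => pullback_rotation_apply α x 1 y
    rw [hT.apply_rotate, this, coe_smul_apply, coe_one_apply, mul_one]

/-- The constant `1` is carried to a constant by rotation invariance, so `T` is known on all powers
of Jacobians. This is the substitute for locality when the target weight is zero. -/
theorem map_derivPow (hT : Equivariant α β T) (f : CircleDiffeo) :
    T (f.derivPow α) = (T 1).1 0 • f.derivPow β := by
  rw [← pullback_one, hT]
  conv_lhs => rw [hT.map_one_eq]
  rw [map_smul, pullback_one]

theorem sub_smul_id (hT : Equivariant α α T) (c : 𝕜) :
    Equivariant α α (T - c • LinearMap.id) := fun f φ => by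
  simp [hT f]

theorem D : Equivariant (0 : 𝕜) 1 (SmoothCircle.D : SmoothCircle 𝕜 →ₗ[𝕜] SmoothCircle 𝕜) :=
  fun f φ => by rw [D_pullback, zero_smul, zero_add, add_zero]

theorem comp {γ : 𝕜} {S : SmoothCircle 𝕜 →ₗ[𝕜] SmoothCircle 𝕜} (hS : Equivariant β γ S)
    (hT : Equivariant α β T) : Equivariant α γ (S ∘ₗ T) := fun f φ => by
  simp only [LinearMap.comp_apply, hT f, hS f]

theorem exp_log_smul_one {k : ℝ} (hk : 0 < k) : NormedSpace.exp (Real.log k • (1 : 𝕜)) = k := by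
  rw [exp_real_smul_one, Real.exp_log hk]

theorem exp_log_smul_neg_one {k : ℝ} (hk : 0 < k) :
    NormedSpace.exp (Real.log k • (-1 : 𝕜)) = (k : 𝕜)⁻¹ := by
  refine eq_inv_of_mul_eq_one_left ?_
  rw [← exp_log_smul_one hk, ← exp_add, ← smul_add]
  simp

theorem exists_contraction (hT : Equivariant α β T) (hβ : β ≠ 0) : ∃ k : ℝ, 0 < k ∧ k < 1 ∧
    ∀ (φ : SmoothCircle 𝕜) (ψ : ℝ → 𝕜), ContDiff ℝ ∞ ψ →
      (∀ x, ψ x - NormedSpace.exp (Real.log k • (α - β)) * ψ (k * x) = φ.1 x) → (T φ).1 0 = 0 := by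
  obtain ⟨k₀, h1, h⟩ := hT.apply_eq_zero_of_homological hβ
  obtain ⟨k, hk, hk1⟩ := exists_between (max_lt h1 one_pos)
  have h0 := (le_max_right _ _).trans_lt hk
  exact ⟨k, h0, hk1, h k h0 ((le_max_left _ _).trans_lt hk) hk1⟩

/-- Here the multiplier is `k`, and the homological equation is solvable for every `φ`. -/
theorem eq_zero_of_lowering (hT : Equivariant (β + 1) β T) (hβ : β ≠ 0) : T = 0 := by
  obtain ⟨k, h0, h1, h⟩ := hT.exists_contraction hβ
  refine LinearMap.ext fun φ => SmoothCircle.ext fun x => ?_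
  rw [hT.apply_rotate]
  obtain ⟨ψ, hψ, e⟩ := exists_sub_mul_comp_eq (pullback (β + 1) (CircleDiffeo.rotation x) φ) h0 h1
  refine h _ ψ hψ fun x => ?_
  rw [← e x, add_sub_cancel_left, exp_log_smul_one h0]

/-- Here the multiplier is `1`. The equation is solvable once `φ(0) = 0`, so `(T φ)(0)` depends on
`φ(0)` only. -/
theorem eq_smul_id (hT : Equivariant β β T) (hβ : β ≠ 0) : ∃ c : 𝕜, T = c • LinearMap.id := by
  obtain ⟨k, h0, h1, h⟩ := hT.exists_contraction hβ
  refine ⟨(T 1).1 0, LinearMap.ext fun φ => SmoothCircle.ext fun x => ?_⟩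
  have key : ∀ φ : SmoothCircle 𝕜, φ.1 0 = 0 → (T φ).1 0 = 0 := fun φ hφ => by
    obtain ⟨ψ, hψ, e⟩ := exists_sub_mul_comp_eq_of_D φ hφ k 1 (by
      simpa only [one_mul] using exists_sub_mul_comp_eq (SmoothCircle.D φ) h0 h1)
    exact h φ ψ hψ fun x => by simpa using e x
  have h₁ := key (pullback β (CircleDiffeo.rotation x) φ - φ.1 x • 1) (by
    rw [coe_sub_apply, coe_smul_apply, pullback_rotation_apply, zero_add, coe_one_apply, mul_one, sub_self])
  rw [map_sub, map_smul, coe_sub_apply, coe_smul_apply, ← hT.apply_rotate, sub_eq_zero] at h₁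
  rw [h₁, mul_comm]
  rfl

/-- The multiplier `k⁻¹` requires the 1-jet of `φ` at `0` to vanish, so `T = a + b D`. Equivariance
on the constant `1` gives `a + b α f''/f' = a f'` for all `f`, whence `a = 0` and `b α = 0`. -/
theorem raising (hT : Equivariant α (α + 1) T) (hβ : α + 1 ≠ 0) :
    ∃ c : 𝕜, T = c • SmoothCircle.D ∧ c * α = 0 := by
  obtain ⟨k, h0, h1, h⟩ := hT.exists_contraction hβ
  have hk : (k : 𝕜) ≠ 0 := by exact_mod_cast h0.ne'
  have key : ∀ φ : SmoothCircle 𝕜, φ.1 0 = 0 → (SmoothCircle.D φ).1 0 = 0 → (T φ).1 0 = 0 :=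
    fun φ hφ hφ' => by
      obtain ⟨ψ, hψ, e⟩ := exists_sub_mul_comp_eq_of_D φ hφ k (k : 𝕜)⁻¹ (by
        rw [inv_mul_cancel₀ hk]
        refine exists_sub_mul_comp_eq_of_D _ hφ' k 1 ?_
        simpa only [one_mul] using exists_sub_mul_comp_eq (SmoothCircle.D (SmoothCircle.D φ)) h0 h1)
      refine h φ ψ hψ fun x => ?_
      rw [← e x, sub_add_cancel_left, exp_log_smul_neg_one h0]
  obtain ⟨s, hs, hs'⟩ := exists_eq_id
  let σ : SmoothCircle 𝕜 := ofReal s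
  have hσ : σ.1 0 = 0 := by simp [σ, hs 0 (by norm_num)]
  have hσ' : (SmoothCircle.D σ).1 0 = 1 := by simp [σ, D_ofReal, hs' 0 (by norm_num)]
  set a := (T 1).1 0 with ha
  set b := (T σ).1 0
  have hab : ∀ φ, T φ = a • φ + b • SmoothCircle.D φ := fun φ => SmoothCircle.ext fun x => by
    set φ' := pullback α (CircleDiffeo.rotation x) φ with hφ'
    have e₁ : φ'.1 0 = φ.1 x := by rw [hφ', pullback_rotation_apply, zero_add]
    have e₂ : (SmoothCircle.D φ').1 0 = (SmoothCircle.D φ).1 x := by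
      rw [hφ', pullback_rotation_D α α, pullback_rotation_apply, zero_add]
    have h₁ := key (φ' - φ.1 x • 1 - (SmoothCircle.D φ).1 x • σ)
      (by simp only [coe_sub_apply, coe_smul_apply, coe_one_apply, hσ, e₁]; ring)
      (by
        rw [map_sub, map_sub, map_smul, map_smul, D_one]
        simp only [coe_sub_apply, coe_smul_apply, hσ', e₂, smul_zero, mul_one, sub_zero]
        simp)
    rw [map_sub, map_sub, map_smul, map_smul, coe_sub_apply, coe_sub_apply, coe_smul_apply, coe_smul_apply,
      ← hT.apply_rotate] at h₁
    rw [coe_add_apply, coe_smul_apply, coe_smul_apply]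
    linear_combination h₁
  have hf : ∀ (f : CircleDiffeo) (x : ℝ),
      a + b * α * (f.logDeriv : SmoothCircle 𝕜).1 x = a * (deriv f.toEquiv x : ℝ) := fun f x => by
    have h₁ := hT.map_derivPow f
    rw [← ha, derivPow_add, hab, D_derivPow] at h₁
    have h₂ := congrArg (fun φ : SmoothCircle 𝕜 => φ.1 x) h₁
    simp only [coe_add_apply, coe_smul_apply, coe_mul_apply, derivPow_one_apply] at h₂
    have h₃ : (f.derivPow α).1 x ≠ 0 := by
      intro h₃
      have := congrArg (fun φ : SmoothCircle 𝕜 => φ.1 x) (f.derivPow_add α (-α))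
      simp [derivPow_zero, coe_mul_apply, coe_one_apply, h₃] at this
    refine mul_right_cancel₀ h₃ ?_
    linear_combination h₂
  obtain ⟨f, x, y, hx, hx', hy, hy'⟩ := exists_logDeriv_ne (𝕜 := 𝕜)
  have ha0 : a = 0 := by
    have := hf f x
    rw [hx', mul_zero, add_zero] at this
    by_contra h
    have h₁ := mul_left_cancel₀ h ((mul_one a).trans this)
    exact hx (by exact_mod_cast h₁.symm)
  refine ⟨b, LinearMap.ext fun φ => by rw [hab, ha0, zero_smul, zero_add]; rfl, ?_⟩
  have := hf f y
  rw [ha0, zero_mul, zero_add] at this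
  exact (mul_eq_zero.1 this).resolve_right hy'

/-- Locality is not available in target weight zero, but `D ∘ T` has target weight `1`. Thus `D T =
c D`, and `T - c` takes constant values; it amounts to an invariant functional, which is zero. -/
theorem eq_smul_id_weight_zero (hT : Equivariant (0 : 𝕜) 0 T) : ∃ c : 𝕜, T = c • LinearMap.id := by
  have hD : Equivariant (0 : 𝕜) (0 + 1) (SmoothCircle.D ∘ₗ T) := by
    rw [zero_add]; exact D.comp hT
  obtain ⟨c, hc, -⟩ := hD.raising (by simp)
  obtain ⟨S, hSdef⟩ : ∃ S : SmoothCircle 𝕜 →ₗ[𝕜] SmoothCircle 𝕜, S = T - c • LinearMap.id :=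
    ⟨_, rfl⟩
  have hS : Equivariant (0 : 𝕜) 0 S := hSdef ▸ hT.sub_smul_id c
  have hc' : ∀ φ, S φ = (S φ).1 0 • 1 := fun φ => eq_smul_one_of_D_eq_zero (by
    have := LinearMap.congr_fun hc φ
    rw [hSdef, LinearMap.sub_apply, map_sub]
    simpa [sub_eq_zero] using this)
  let e : SmoothCircle 𝕜 →ₗ[𝕜] 𝕜 :=
    { toFun := fun φ => φ.1 0, map_add' := fun _ _ => rfl, map_smul' := fun _ _ => rfl }
  have hℓ : e ∘ₗ S = 0 := by
    refine invariant_functional_eq_zero fun f φ => ?_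
    have h₁ := hS f φ
    rw [pullback_eq, derivPow_zero, one_mul] at h₁
    rw [LinearMap.comp_apply, LinearMap.comp_apply, h₁, hc' φ, map_smul, map_smul, map_smul,
      pullback_one, derivPow_zero]
  have hS0 : S = 0 := LinearMap.ext fun φ => by
    rw [hc', show (S φ).1 0 = 0 from LinearMap.congr_fun hℓ φ, zero_smul]
    rfl
  exact ⟨c, sub_eq_zero.1 (hSdef ▸ hS0)⟩

theorem exists_eq_smul_id (hT : Equivariant α α T) : ∃ c : 𝕜, T = c • LinearMap.id := by
  by_cases h : α = 0
  · subst h; exact hT.eq_smul_id_weight_zero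
  · exact hT.eq_smul_id h

/-- Invariant maps from one-forms to functions are multiples of the integral. -/
theorem eq_smul_mean (hT : Equivariant (1 : 𝕜) 0 T) :
    ∃ c : 𝕜, ∀ φ, T φ = (c * mean φ) • 1 := by
  have h₀ : ∀ p : SmoothCircle ℝ, T (SmoothCircle.D (ofReal p)) = 0 := fun p => by
    obtain ⟨ε₀, hε₀, hε⟩ := exists_small p
    obtain ⟨ε, hε0, hε1⟩ := exists_between hε₀
    -- The Jacobian is `1 + ε p'`, and `T` sends every Jacobian to `T 1`; hence `T p' = 0`.
    let f := ofPerturb (ε • p) (hε ε (by rwa [abs_of_pos hε0]))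
    have e : f.derivPow (1 : 𝕜) = 1 + (ε : 𝕜) • SmoothCircle.D (ofReal p) :=
      SmoothCircle.ext fun x => by
        rw [derivPow_one_apply, deriv_ofPerturb, D_ofReal, map_smul]
        change ((1 + ε * (SmoothCircle.D p).1 x : ℝ) : 𝕜) = 1 + ε * ((SmoothCircle.D p).1 x : ℝ)
        push_cast
        rfl
    have h₁ := hT.map_derivPow f
    rw [derivPow_zero, ← hT.map_one_eq, e, map_add, map_smul, add_eq_left] at h₁
    exact (smul_eq_zero.1 h₁).resolve_left (by exact_mod_cast hε0.ne')
  have h₁ : T ∘ₗ SmoothCircle.D = 0 := linearMap_eq_zero h₀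
  refine ⟨(T 1).1 0, fun φ => ?_⟩
  obtain ⟨ψ, hψ⟩ := exists_eq_mean_add_D φ
  conv_lhs => rw [hψ]
  rw [map_add, map_smul, show T (SmoothCircle.D ψ) = 0 from LinearMap.congr_fun h₁ ψ, add_zero,
    mul_comm, mul_smul, ← hT.map_one_eq]

/-- Every positive function is, up to a constant, the Jacobian of a diffeomorphism. -/
theorem exists_deriv_eq (w : SmoothCircle ℝ) (hw : ∀ x, 0 < w.1 x) :
    ∃ (m : ℝ) (f : CircleDiffeo), 0 < m ∧ ∀ x, w.1 x = m * deriv f.toEquiv x := by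
  obtain ⟨P, hP⟩ := exists_eq_mean_add_D w
  set m := mean w
  have hP' : ∀ x, w.1 x = m + (SmoothCircle.D P).1 x := fun x => by
    conv_lhs => rw [hP]
    rw [coe_add_apply, coe_smul_apply, coe_one_apply, mul_one]
  have hm : 0 < m := by
    -- At a point given by Rolle's theorem for the periodic `P`, the value of `w` is its mean, which
    -- is therefore positive.
    obtain ⟨x, -, hx⟩ := exists_deriv_eq_zero (f := P.1) one_pos P.2.1.continuous.continuousOn
      (by simpa using (P.2.2 0).symm)
    have := hP' x
    rw [show (SmoothCircle.D P).1 x = 0 from hx, add_zero] at this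
    exact this ▸ hw x
  have h₁ : ∀ x, (SmoothCircle.D (m⁻¹ • P)).1 x = m⁻¹ * (SmoothCircle.D P).1 x := fun x => by
    rw [map_smul]; rfl
  refine ⟨m, ofPerturb (m⁻¹ • P) fun x => ?_, hm, fun x => ?_⟩
  · rw [h₁, ← sub_pos]
    have : m⁻¹ * (SmoothCircle.D P).1 x - -1 = m⁻¹ * w.1 x := by
      rw [hP']; field_simp; ring
    rw [this]
    exact mul_pos (inv_pos.2 hm) (hw x)
  · rw [deriv_ofPerturb, h₁, hP']
    field_simp

/-- There is no nonzero invariant map from vector fields to functions. -/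
theorem eq_zero_of_neg_one (hT : Equivariant (-1 : 𝕜) 0 T) : T = 0 := by
  have hinv : ∀ (f : CircleDiffeo) (x : ℝ),
      (f.derivPow (-1 : 𝕜)).1 x = ((deriv f.toEquiv x : ℝ) : 𝕜)⁻¹ := fun f x => by
    rw [derivPow_apply, exp_log_smul_neg_one (f.deriv_pos x)]
  have h₁ : ∀ f : CircleDiffeo, T (f.derivPow (-1)) = T 1 := fun f => by
    rw [hT.map_derivPow, derivPow_zero, ← hT.map_one_eq]
  have h1 : T 1 = 0 := by
    obtain ⟨f, hf⟩ := exists_wave one_ne_zero (ε := 1 / 2) (by rw [abs_of_pos] <;> norm_num)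
    obtain ⟨g, hg⟩ := exists_wave one_ne_zero (ε := -(1 / 2)) (by rw [abs_neg, abs_of_pos] <;> norm_num)
    obtain ⟨h, hh⟩ := exists_wave two_ne_zero (ε := -(1 / 7)) (by rw [abs_neg, abs_of_pos] <;> norm_num)
    -- With `C = cos 2πx`, `1/(1 + C/2) + 1/(1 - C/2) = 2/(1 - C²/4) = (16/7) / (1 - cos(4πx)/7)`.
    -- All three inverse Jacobians have image `T 1`, so `14 T 1 = 16 T 1`.
    have e : (7 : 𝕜) • (f.derivPow (-1 : 𝕜) + g.derivPow (-1)) = (16 : 𝕜) • h.derivPow (-1) :=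
      SmoothCircle.ext fun x => by
        rw [coe_smul_apply, coe_add_apply, coe_smul_apply, hinv, hinv, hinv]
        have : 7 * ((deriv f.toEquiv x)⁻¹ + (deriv g.toEquiv x)⁻¹) =
            16 * (deriv h.toEquiv x)⁻¹ := by
          have h₁ := (f.deriv_pos x).ne'
          have h₂ := (g.deriv_pos x).ne'
          have h₃ := (h.deriv_pos x).ne'
          have h₄ : 2 * Real.pi * (2 : ℕ) * x = 2 * (2 * Real.pi * (1 : ℕ) * x) := by
            push_cast; ring
          field_simp
          rw [hf, hg, hh, h₄, Real.cos_two_mul]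
          ring
        exact_mod_cast congrArg (fun r : ℝ => (r : 𝕜)) this
    have h₂ := congrArg T e
    rw [map_smul, map_smul, map_add, h₁, h₁, h₁, ← two_smul 𝕜, smul_smul, ← sub_eq_zero,
      ← sub_smul] at h₂
    exact (smul_eq_zero.1 h₂).resolve_left (by norm_num)
  refine linearMap_eq_zero fun p => ?_
  obtain ⟨C, hC0, hC⟩ := exists_bound p
  have hpos : ∀ x, 0 < p.1 x + (C + 1) := fun x => by
    have := (abs_le.1 (hC x)).1
    linarith
  -- Shifted to be positive, `p` is a multiple of an inverse Jacobian, so its image is a multiple of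
  -- `T 1 = 0`.
  obtain ⟨m, f, hm, hf⟩ := exists_deriv_eq ⟨fun x => (p.1 x + (C + 1))⁻¹,
    (p.2.1.add contDiff_const).inv fun x => (hpos x).ne', fun x => by simp only [p.2.2 x]⟩
    fun x => inv_pos.2 (hpos x)
  have e : (ofReal p : SmoothCircle 𝕜) =
      ((m⁻¹ : ℝ) : 𝕜) • f.derivPow (-1) - ((C + 1 : ℝ) : 𝕜) • 1 := SmoothCircle.ext fun x => by
    rw [coe_sub_apply, coe_smul_apply, coe_smul_apply, coe_one_apply, mul_one, hinv, ofReal_apply]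
    have : p.1 x = m⁻¹ * (deriv f.toEquiv x)⁻¹ - (C + 1) := by
      have h₂ : (p.1 x + (C + 1))⁻¹ = m * deriv f.toEquiv x := hf x
      rw [← mul_inv, ← h₂, inv_inv]
      ring
    exact_mod_cast congrArg (fun r : ℝ => (r : 𝕜)) this
  rw [e, map_sub, map_smul, map_smul, h₁, h1, smul_zero, smul_zero, sub_zero]

end Equivariant

/-! ### Further identities for pull-backs and Jacobians -/

namespace Density

open SmoothCircle

variable {𝕜 : Type*} [RCLike 𝕜]

theorem pullback_mul_pullback (α β : 𝕜) (f : CircleDiffeo) (φ ψ : SmoothCircle 𝕜) :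
    pullback α f φ * pullback β f ψ = pullback (α + β) f (φ * ψ) := by
  simp only [pullback_eq, f.derivPow_add, map_mul]
  ring

theorem pullback_zero_one (f : CircleDiffeo) : pullback (0 : 𝕜) f 1 = 1 := by
  rw [pullback_one, f.derivPow_zero]

theorem pullback_pullback_symm (α : 𝕜) (f : CircleDiffeo) (φ : SmoothCircle 𝕜) :
    pullback α f (pullback α f.symm φ) = φ :=
  SmoothCircle.ext fun x => by
    have h₁ := f.deriv_mul_deriv_symm (f.toEquiv x)
    rw [Equiv.symm_apply_apply] at h₁
    have h₂ : deriv f.toEquiv.symm (f.toEquiv x) ≠ 0 := right_ne_zero_of_mul_eq_one h₁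
    rw [pullback_apply, pullback_apply]
    change _ * (NormedSpace.exp (Real.log (deriv f.toEquiv.symm (f.toEquiv x)) • α) *
      φ.1 (f.toEquiv.symm (f.toEquiv x))) = _
    rw [← mul_assoc, ← CircleDiffeo.exp_add, ← add_smul,
      ← Real.log_mul (f.deriv_pos x).ne' h₂, h₁]
    simp

theorem eq_smul_one_of_rotation {α : 𝕜} {φ : SmoothCircle 𝕜}
    (h : ∀ t, pullback α (CircleDiffeo.rotation t) φ = φ) : φ = φ.1 0 • 1 :=
  SmoothCircle.ext fun x => by
    conv_rhs => rw [← h x]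
    rw [coe_smul_apply, coe_one_apply, pullback_rotation_apply, zero_add, mul_one]

end Density

namespace CircleDiffeo

open SmoothCircle

variable {𝕜 : Type*} [RCLike 𝕜]

theorem logDeriv_rotation (t : ℝ) : ((rotation t).logDeriv : SmoothCircle 𝕜) = 0 :=
  SmoothCircle.ext fun x => by
    rw [logDeriv_apply, funext (deriv_rotation t), deriv_const]
    simp

/-- The Jacobian `f' ↦ f'' / f'` is not an affine map. -/
theorem exists_derivPow_add_eq_two : ∃ (f g : CircleDiffeo),
    f.derivPow (1 : 𝕜) + g.derivPow 1 = (2 : 𝕜) • 1 ∧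
      (f.logDeriv + g.logDeriv : SmoothCircle 𝕜) ≠ 0 := by
  obtain ⟨f, hf⟩ := exists_wave one_ne_zero (ε := 1 / 2) (by rw [abs_of_pos] <;> norm_num)
  obtain ⟨g, hg⟩ := exists_wave one_ne_zero (ε := -(1 / 2))
    (by rw [abs_neg, abs_of_pos] <;> norm_num)
  simp only [Nat.cast_one, mul_one] at hf hg
  refine ⟨f, g, SmoothCircle.ext fun x => ?_, fun h => ?_⟩
  · rw [coe_add_apply, derivPow_one_apply, derivPow_one_apply, hf, hg, coe_smul_apply,
      coe_one_apply]
    push_cast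
    ring
  -- The sum of logarithmic derivatives is `π sin(2πx) cos(2πx) / (f' g')`, which is nonzero at
  -- `1/8`.
  · have h₁ := congrArg (fun φ : SmoothCircle 𝕜 => φ.1 (1 / 8)) h
    simp only [coe_add_apply, logDeriv_wave hf, logDeriv_wave hg] at h₁
    have h₂ : -(2 * Real.pi * (1 / 2) * Real.sin (2 * Real.pi * (1 / 8))) / deriv f.toEquiv (1 / 8) +
        -(2 * Real.pi * -(1 / 2) * Real.sin (2 * Real.pi * (1 / 8))) / deriv g.toEquiv (1 / 8) = 0 := by
      rw [← RCLike.ofReal_add] at h₁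
      exact RCLike.ofReal_eq_zero.1 h₁
    have hf0 := (f.deriv_pos (1 / 8)).ne'
    have hg0 := (g.deriv_pos (1 / 8)).ne'
    have e : 2 * Real.pi * (1 / 8) = Real.pi / 4 := by ring
    have h2 : (0 : ℝ) < √2 := by positivity
    rw [e] at h₂
    field_simp at h₂
    rw [hf, hg, e, Real.sin_pi_div_four, Real.cos_pi_div_four] at h₂
    nlinarith [Real.pi_pos, mul_pos h2 h2]

end CircleDiffeo

/-! ### First-order operators as pairs of functions -/

namespace DiffOps

open SmoothCircle Density

variable {𝕜 : Type*} [RCLike 𝕜]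

/-- The first-order operator `u ∂ + (v - κ u')`. -/
noncomputable def ofSymbols (lam mu κ : 𝕜) :
    SmoothCircle 𝕜 × SmoothCircle 𝕜 →ₗ[𝕜] DiffOps 1 lam mu where
  toFun w := ⟨LinearMap.mulLeft 𝕜 (w.2 - κ • D w.1) + LinearMap.mulLeft 𝕜 w.1 ∘ₗ D,
    ![w.2 - κ • D w.1, w.1], LinearMap.ext fun φ => by simp [diffOp]⟩
  map_add' w w' := Subtype.ext <| LinearMap.ext fun φ => by
    simp [add_mul, sub_mul]
    ring
  map_smul' c w := Subtype.ext <| LinearMap.ext fun φ => by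
    simp [sub_mul, smul_sub, smul_smul, mul_comm κ c]

theorem ofSymbols_apply (lam mu κ : 𝕜) (w : SmoothCircle 𝕜 × SmoothCircle 𝕜) (φ : SmoothCircle 𝕜) :
    (ofSymbols lam mu κ w).1 φ = (w.2 - κ • D w.1) * φ + w.1 * D φ := rfl

theorem ofSymbols_bijective (lam mu κ : 𝕜) : Function.Bijective (ofSymbols lam mu κ) := by
  constructor
  · intro w w' h
    have h₁ : ∀ φ, (w.2 - κ • D w.1) * φ + w.1 * D φ = (w'.2 - κ • D w'.1) * φ + w'.1 * D φ :=
      fun φ => by rw [← ofSymbols_apply, ← ofSymbols_apply, h]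
    have h₂ : w.2 - κ • D w.1 = w'.2 - κ • D w'.1 := by simpa [D_one] using h₁ 1
    have hu : w.1 = w'.1 := SmoothCircle.ext fun x => by
      -- The translated sine has derivative `1` at `x`, so it reads off the leading coefficient
      -- there.
      have h₃ := h₁ (pullback 0 (CircleDiffeo.rotation (-x)) (ofReal (sine 1)))
      rw [h₂, add_right_inj, pullback_rotation_D 0 0, D_ofReal] at h₃
      have h₄ := congrArg (fun φ : SmoothCircle 𝕜 => φ.1 x) h₃
      simpa only [coe_mul_apply, pullback_rotation_apply, ofReal_apply,
        D_sine one_ne_zero, add_neg_cancel, mul_zero, Real.cos_zero, RCLike.ofReal_one,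
        mul_one] using h₄
    rw [hu, sub_left_inj] at h₂
    exact Prod.ext hu h₂
  · rintro ⟨_, a, rfl⟩
    refine ⟨(a 1, a 0 + κ • D (a 1)), Subtype.ext <| LinearMap.ext fun φ => ?_⟩
    rw [ofSymbols_apply]
    simp [diffOp]

/-- The action of a diffeomorphism in the coordinates `DiffOps.ofSymbols`. -/
noncomputable def symbolAction (α β γ : 𝕜) (f : CircleDiffeo) :
    Module.End 𝕜 (SmoothCircle 𝕜 × SmoothCircle 𝕜) where
  toFun w := (pullback α f w.1, pullback β f w.2 + γ • (f.logDeriv * pullback α f w.1))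
  map_add' w w' := by
    ext1
    · simp
    · simp only [Prod.snd_add, Prod.fst_add, map_add, mul_add, smul_add]
      abel
  map_smul' c w := by
    ext1
    · simp
    · simp [smul_smul, mul_comm γ c]

theorem symbolAction_apply (α β γ : 𝕜) (f : CircleDiffeo) (u v : SmoothCircle 𝕜) :
    symbolAction α β γ f (u, v) =
      (pullback α f u, pullback β f v + γ • (f.logDeriv * pullback α f u)) := rfl

/-- Differentiating the argument of weight `lam` contributes `-lam` to the cocycle coefficient, and
transforming `u'` contributes `κ (mu - lam - 1)`. The operator action of `f.symm` appears because it
is pull-back along `f`. -/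
theorem diffOpsAction_ofSymbols (lam mu κ : 𝕜) (f : CircleDiffeo)
    (w : SmoothCircle 𝕜 × SmoothCircle 𝕜) :
    diffOpsAction 1 lam mu f.symm (ofSymbols lam mu κ w) =
      ofSymbols lam mu κ (symbolAction (mu - lam - 1) (mu - lam) (κ * (mu - lam - 1) - lam) f w) := by
  obtain ⟨u, v⟩ := w
  refine Subtype.ext <| LinearMap.ext fun φ => ?_
  obtain ⟨ψ, rfl⟩ : ∃ ψ, φ = pullback lam f ψ := ⟨_, (pullback_pullback_symm lam f φ).symm⟩
  have h₁ : (diffOpsAction 1 lam mu f.symm (ofSymbols lam mu κ (u, v))).1 (pullback lam f ψ) =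
      pullback mu f ((ofSymbols lam mu κ (u, v)).1 (pullback lam f.symm (pullback lam f ψ))) := rfl
  have h₂ : pullback lam f.symm (pullback lam f ψ) = ψ := pullback_pullback_symm lam f.symm ψ
  rw [h₁, h₂, ofSymbols_apply, symbolAction_apply, ofSymbols_apply]
  have hD : D (pullback (mu - lam - 1) f u) = pullback (mu - lam) f (D u) +
      (mu - lam - 1) • (f.logDeriv * pullback (mu - lam - 1) f u) := by
    have := D_pullback (mu - lam - 1) f u
    rwa [sub_add_cancel] at this
  rw [hD, D_pullback]
  have h₃ : ∀ φ, pullback (mu - lam) f φ * pullback lam f ψ = pullback mu f (φ * ψ) :=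
    fun φ => by rw [pullback_mul_pullback, sub_add_cancel]
  have h₄ := pullback_mul_pullback (mu - lam - 1) (lam + 1) f u (D ψ)
  rw [show mu - lam - 1 + (lam + 1) = mu by ring] at h₄
  rw [map_add, ← h₃, ← h₄, map_sub, map_smul]
  simp only [Algebra.smul_def, map_sub, map_mul]
  ring

/-- Reduces each case to a faithful representation of the matrix algebra on pairs whose image is
exactly the commutant of the action. -/
theorem nonempty_symmetryAlgebra_equiv {B : Type*} [Semiring B] [Algebra 𝕜 B] {lam mu : 𝕜}
    (κ : 𝕜) (Φ : B →ₐ[𝕜] Module.End 𝕜 (SmoothCircle 𝕜 × SmoothCircle 𝕜))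
    (hinj : Function.Injective Φ)
    (h : ∀ S, (∃ b, Φ b = S) ↔ ∀ f w,
      S (symbolAction (mu - lam - 1) (mu - lam) (κ * (mu - lam - 1) - lam) f w) =
        symbolAction (mu - lam - 1) (mu - lam) (κ * (mu - lam - 1) - lam) f (S w)) :
    Nonempty (symmetryAlgebra 1 lam mu ≃ₐ[𝕜] B) := by
  let E := LinearEquiv.ofBijective _ (ofSymbols_bijective lam mu κ)
  have hE : ∀ f w, diffOpsAction 1 lam mu f (E w) = E (symbolAction (mu - lam - 1) (mu - lam)
      (κ * (mu - lam - 1) - lam) f.symm w) := fun f w =>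
    diffOpsAction_ofSymbols lam mu κ f.symm w
  let Ψ := (E.conjAlgEquiv 𝕜).toAlgHom.comp Φ
  have hΨ : Function.Injective Ψ := (E.conjAlgEquiv 𝕜).injective.comp hinj
  have hrange : Ψ.range = symmetryAlgebra 1 lam mu := by
    ext T
    rw [symmetryAlgebra, Subalgebra.mem_centralizer_iff, Set.forall_mem_range]
    have h₁ : T ∈ Ψ.range ↔ ∃ b, Φ b = (E.conjAlgEquiv 𝕜).symm T := by
      constructor
      · rintro ⟨b, hb⟩
        exact ⟨b, ((E.conjAlgEquiv 𝕜).symm_apply_eq.2 hb.symm).symm⟩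
      · rintro ⟨b, hb⟩
        exact ⟨b, (E.conjAlgEquiv 𝕜).symm_apply_eq.1 hb.symm |>.symm⟩
    have h₂ : ∀ w, (E.conjAlgEquiv 𝕜).symm T w = E.symm (T (E w)) := fun w => rfl
    rw [h₁, h]
    simp only [h₂]
    constructor
    · intro H f
      refine LinearMap.ext fun A => ?_
      obtain ⟨w, rfl⟩ := E.surjective A
      have := congrArg E (H f.symm w)
      rw [← hE, E.apply_symm_apply, ← hE, E.apply_symm_apply] at this
      rw [Module.End.mul_apply, Module.End.mul_apply, ← this]
    · intro H f w
      have := LinearMap.congr_fun (H f.symm) (E w)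
      rw [Module.End.mul_apply, Module.End.mul_apply, hE] at this
      rw [E.symm_apply_eq, ← show f.symm.symm = f from rfl, ← this, ← hE, E.apply_symm_apply]
  exact ⟨((AlgEquiv.ofInjective Ψ hΨ).trans (Subalgebra.equivOfEq _ _ hrange)).symm⟩

end DiffOps

/-! ### Commutants of the action on pairs -/

namespace DiffOps

open SmoothCircle Density

variable {𝕜 : Type*} [RCLike 𝕜]

theorem symbolAction_inl (α β γ : 𝕜) (f : CircleDiffeo) (u : SmoothCircle 𝕜) :
    symbolAction α β γ f (u, 0) = (pullback α f u, γ • (f.logDeriv * pullback α f u)) := by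
  rw [symbolAction_apply, map_zero, zero_add]

theorem symbolAction_inr (α β γ : 𝕜) (f : CircleDiffeo) (v : SmoothCircle 𝕜) :
    symbolAction α β γ f (0, v) = (0, pullback β f v) := by
  rw [symbolAction_apply, map_zero, mul_zero, smul_zero, add_zero]

section

variable (S : Module.End 𝕜 (SmoothCircle 𝕜 × SmoothCircle 𝕜))

/-- The blocks of an endomorphism of the space of pairs of functions. -/
noncomputable def block₁₁ : SmoothCircle 𝕜 →ₗ[𝕜] SmoothCircle 𝕜 :=
  LinearMap.fst 𝕜 _ _ ∘ₗ S ∘ₗ LinearMap.inl 𝕜 _ _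

noncomputable def block₁₂ : SmoothCircle 𝕜 →ₗ[𝕜] SmoothCircle 𝕜 :=
  LinearMap.fst 𝕜 _ _ ∘ₗ S ∘ₗ LinearMap.inr 𝕜 _ _

noncomputable def block₂₁ : SmoothCircle 𝕜 →ₗ[𝕜] SmoothCircle 𝕜 :=
  LinearMap.snd 𝕜 _ _ ∘ₗ S ∘ₗ LinearMap.inl 𝕜 _ _

noncomputable def block₂₂ : SmoothCircle 𝕜 →ₗ[𝕜] SmoothCircle 𝕜 :=
  LinearMap.snd 𝕜 _ _ ∘ₗ S ∘ₗ LinearMap.inr 𝕜 _ _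

theorem apply_eq_blocks (u v : SmoothCircle 𝕜) :
    S (u, v) = (block₁₁ S u + block₁₂ S v, block₂₁ S u + block₂₂ S v) := by
  have : ((u, v) : SmoothCircle 𝕜 × SmoothCircle 𝕜) = (u, 0) + (0, v) := by simp
  rw [this, map_add]
  rfl

variable {S} {α β γ : 𝕜}

theorem blocks_inl (hS : ∀ f w, S (symbolAction α β γ f w) = symbolAction α β γ f (S w))
    (f : CircleDiffeo) (u : SmoothCircle 𝕜) :
    block₁₁ S (pullback α f u) + block₁₂ S (γ • (f.logDeriv * pullback α f u)) =
        pullback α f (block₁₁ S u) ∧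
      block₂₁ S (pullback α f u) + block₂₂ S (γ • (f.logDeriv * pullback α f u)) =
        pullback β f (block₂₁ S u) + γ • (f.logDeriv * pullback α f (block₁₁ S u)) := by
  have h := hS f (u, 0)
  rw [symbolAction_inl, apply_eq_blocks S, apply_eq_blocks S, symbolAction_apply, map_zero, map_zero,
    add_zero, add_zero] at h
  exact Prod.mk.inj h

theorem blocks_inr (hS : ∀ f w, S (symbolAction α β γ f w) = symbolAction α β γ f (S w))
    (f : CircleDiffeo) (v : SmoothCircle 𝕜) :
    block₁₂ S (pullback β f v) = pullback α f (block₁₂ S v) ∧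
      block₂₂ S (pullback β f v) =
        pullback β f (block₂₂ S v) + γ • (f.logDeriv * pullback α f (block₁₂ S v)) := by
  have h := hS f (0, v)
  rw [symbolAction_inr, apply_eq_blocks S, apply_eq_blocks S, symbolAction_apply, map_zero, map_zero,
    zero_add, zero_add, zero_add, zero_add] at h
  exact Prod.mk.inj h

theorem block_equivariant
    (hS : ∀ f w, S (symbolAction α β 0 f w) = symbolAction α β 0 f (S w)) :
    Equivariant α α (block₁₁ S) ∧ Equivariant (β) α (block₁₂ S) ∧
      Equivariant α (β) (block₂₁ S) ∧ Equivariant (β) (β) (block₂₂ S) := by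
  refine ⟨fun f φ => ?_, fun f φ => ?_, fun f φ => ?_, fun f φ => ?_⟩
  · simpa using (blocks_inl hS f φ).1
  · simpa using (blocks_inr hS f φ).1
  · simpa using (blocks_inl hS f φ).2
  · simpa using (blocks_inr hS f φ).2

theorem commute_iff_of_ne_zero (hα : α ≠ 0) :
    (∃ a b : 𝕜, ∀ u v, S (u, v) = (a • u, b • v)) ↔
      ∀ f w, S (symbolAction α (α + 1) 0 f w) = symbolAction α (α + 1) 0 f (S w) := by
  constructor
  · rintro ⟨a, b, h⟩ f ⟨u, v⟩
    simp [symbolAction_apply, h]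
  · intro hS
    obtain ⟨h₁₁, h₁₂, h₂₁, h₂₂⟩ := block_equivariant hS
    obtain ⟨a, ha⟩ := h₁₁.exists_eq_smul_id
    obtain ⟨b, hb⟩ := h₂₂.exists_eq_smul_id
    have h₁ : block₁₂ S = 0 := h₁₂.eq_zero_of_lowering hα
    have h₂ : block₂₁ S = 0 := by
      -- For `α = -1` the target weight is zero, where the local classification does not apply.
      by_cases hβ : α + 1 = 0
      · obtain rfl : α = -1 := eq_neg_of_add_eq_zero_left hβ
        rw [hβ] at h₂₁
        exact h₂₁.eq_zero_of_neg_one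
      · obtain ⟨c, hc, hc'⟩ := h₂₁.raising hβ
        rw [hc, (mul_eq_zero.1 hc').resolve_right hα, zero_smul]
    refine ⟨a, b, fun u v => ?_⟩
    rw [apply_eq_blocks, ha, hb, h₁, h₂]
    simp

theorem commute_iff_of_zero_zero :
    (∃ a b c d : 𝕜, ∀ u v, S (u, v) = (a • u + (d * mean v) • 1, b • v + c • D u)) ↔
      ∀ f w, S (symbolAction 0 1 0 f w) = symbolAction 0 1 0 f (S w) := by
  constructor
  · rintro ⟨a, b, c, d, h⟩ f ⟨u, v⟩
    have hD := Equivariant.D (𝕜 := 𝕜) f u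
    simp [symbolAction_apply, h, mean_pullback_one, hD, pullback_zero_one]
  · intro hS
    obtain ⟨h₁₁, h₁₂, h₂₁, h₂₂⟩ := block_equivariant hS
    obtain ⟨a, ha⟩ := h₁₁.exists_eq_smul_id
    obtain ⟨b, hb⟩ := h₂₂.exists_eq_smul_id
    rw [← zero_add (1 : 𝕜)] at h₂₁
    obtain ⟨c, hc, -⟩ := h₂₁.raising (by simp)
    obtain ⟨d, hd⟩ := h₁₂.eq_smul_mean
    refine ⟨a, b, c, d, fun u v => ?_⟩
    rw [apply_eq_blocks, ha, hb, hc, hd]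
    simp [add_comm]

/-- The cocycle couples the blocks: it first rules out the integral, then equates the diagonal
scalars; only then is the remaining block equivariant. -/
theorem commute_iff_of_cocycle (hγ : γ ≠ 0) :
    (∃ a b : 𝕜, ∀ u v, S (u, v) = (a • u, a • v + b • D u)) ↔
      ∀ f w, S (symbolAction 0 1 γ f w) = symbolAction 0 1 γ f (S w) := by
  constructor
  · rintro ⟨a, b, h⟩ f ⟨u, v⟩
    have hD := Equivariant.D (𝕜 := 𝕜) f u
    simp only [symbolAction_apply, h, hD, map_add, map_smul, mul_smul_comm, smul_add,
      smul_smul, mul_comm γ a]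
    congr 1
    abel
  · intro hS
    have hinl := blocks_inl hS
    have hinr := blocks_inr hS
    have h₁₂ : Equivariant (1 : 𝕜) 0 (block₁₂ S) := fun f φ => (hinr f φ).1
    obtain ⟨m, hm⟩ := h₁₂.eq_smul_mean
    have h1 : block₁₂ S 1 = m • 1 := by rw [hm, mean_one, mul_one]
    have hrot : ∀ t, pullback (1 : 𝕜) (CircleDiffeo.rotation t) 1 = 1 := fun t =>
      SmoothCircle.ext fun x => pullback_rotation_apply 1 t 1 x
    have e : block₂₂ S 1 = (block₂₂ S 1).1 0 • 1 := eq_smul_one_of_rotation (α := 1) fun t => by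
      have := (hinr (CircleDiffeo.rotation t) 1).2
      rw [hrot, CircleDiffeo.logDeriv_rotation, zero_mul, smul_zero, add_zero] at this
      exact this.symm
    have hjac : ∀ f : CircleDiffeo, block₂₂ S (f.derivPow 1) =
        (block₂₂ S 1).1 0 • f.derivPow 1 + (γ * m) • f.logDeriv := fun f => by
      have := (hinr f 1).2
      rw [pullback_one, h1, map_smul, pullback_zero_one] at this
      rw [this]
      conv_lhs => rw [e]
      rw [map_smul, pullback_one, mul_smul_comm, mul_one, smul_smul]
    -- By `hjac`, a linear map sends `f'` to a multiple of `f'` plus `γ m f''/f'`. Two Jacobians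
    -- with `f' + g' = 2` whose logarithmic derivatives do not cancel force `m = 0`.
    obtain ⟨f, g, hfg, hne⟩ := CircleDiffeo.exists_derivPow_add_eq_two (𝕜 := 𝕜)
    have hm0 : m = 0 := by
      have h' : ((block₂₂ S 1).1 0) • (f.derivPow (1 : 𝕜) + g.derivPow 1) +
          (γ * m) • (f.logDeriv + g.logDeriv) = (2 : 𝕜) • (block₂₂ S 1).1 0 • 1 := by
        rw [← e, ← map_smul, ← hfg, map_add, hjac, hjac, smul_add, smul_add]
        abel
      rw [hfg, smul_comm, add_eq_left] at h'
      exact (mul_eq_zero.1 ((smul_eq_zero.1 h').resolve_right hne)).resolve_left hγ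
    have h₁₂' : ∀ φ, block₁₂ S φ = 0 := fun φ => by rw [hm, hm0, zero_mul, zero_smul]
    simp only [h₁₂', map_zero, mul_zero, smul_zero, add_zero, true_and] at hinl hinr
    have h₂₂ : Equivariant (1 : 𝕜) 1 (block₂₂ S) := fun f φ => hinr f φ
    have h₁₁ : Equivariant (0 : 𝕜) 0 (block₁₁ S) := fun f φ => (hinl f φ).1
    obtain ⟨a, ha⟩ := h₁₁.exists_eq_smul_id
    obtain ⟨b, hb⟩ := h₂₂.exists_eq_smul_id
    have h₂₁ : ∀ (f : CircleDiffeo) (u : SmoothCircle 𝕜),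
        block₂₁ S (pullback 0 f u) + (b * γ) • (f.logDeriv * pullback 0 f u) =
          pullback 1 f (block₂₁ S u) + (a * γ) • (f.logDeriv * pullback 0 f u) := fun f u => by
      have := (hinl f u).2
      rw [ha, hb] at this
      simpa [smul_smul, mul_comm γ] using this
    have hab : a = b := by
      have e' : block₂₁ S 1 = (block₂₁ S 1).1 0 • 1 := eq_smul_one_of_rotation (α := 1) fun t => by
        have := h₂₁ (CircleDiffeo.rotation t) 1
        rw [CircleDiffeo.logDeriv_rotation, zero_mul, smul_zero, smul_zero, add_zero, add_zero,
          pullback_zero_one] at this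
        exact this.symm
      -- Where `f' = 1` the Jacobian terms agree and only `(b - a) γ f''/f'` is left, with `f''/f' ≠
      -- 0`.
      obtain ⟨f, -, y, -, -, hy, hy'⟩ := CircleDiffeo.exists_logDeriv_ne (𝕜 := 𝕜)
      have h₁ := h₂₁ f 1
      rw [pullback_zero_one, mul_one, e', map_smul, pullback_one] at h₁
      have h₂ := congrArg (fun φ : SmoothCircle 𝕜 => φ.1 y) h₁
      simp only [coe_add_apply, coe_smul_apply, coe_one_apply, CircleDiffeo.derivPow_one_apply, hy,
        RCLike.ofReal_one, add_right_inj] at h₂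
      exact (mul_right_cancel₀ hγ (mul_right_cancel₀ hy' h₂)).symm
    have hD : Equivariant (0 : 𝕜) (0 + 1) (block₂₁ S) := fun f u => by
      have := h₂₁ f u
      rw [hab, add_left_inj] at this
      rwa [zero_add]
    obtain ⟨c, hc, -⟩ := hD.raising (by simp)
    refine ⟨a, c, fun u v => ?_⟩
    rw [apply_eq_blocks, h₁₂', ha, hb, hc, hab]
    simp [add_comm]

end

/-! ### Representations of the matrix algebras on pairs -/

/-- The action of a pair of scalars on pairs of functions. -/
noncomputable def scalarAction :
    (Fin 2 → 𝕜) →ₐ[𝕜] Module.End 𝕜 (SmoothCircle 𝕜 × SmoothCircle 𝕜) :=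
  AlgHom.ofLinearMap
    { toFun := fun c => LinearMap.prodMap (c 0 • LinearMap.id) (c 1 • LinearMap.id)
      map_add' := fun c d => LinearMap.ext fun w => by simp [add_smul]
      map_smul' := fun r c => LinearMap.ext fun w => by simp [mul_smul] }
    (LinearMap.ext fun w => by simp)
    (fun c d => LinearMap.ext fun w => by
      ext1
      · exact mul_smul (c 0) (d 0) w.1
      · exact mul_smul (c 1) (d 1) w.2)

theorem scalarAction_apply (c : Fin 2 → 𝕜) (u v : SmoothCircle 𝕜) :
    scalarAction c (u, v) = (c 0 • u, c 1 • v) := rfl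

/-- The action of `algA` on pairs of functions: its nilpotent generator acts by the derivative. -/
noncomputable def algAAction :
    algA 𝕜 →ₐ[𝕜] Module.End 𝕜 (SmoothCircle 𝕜 × SmoothCircle 𝕜) :=
  AlgHom.ofLinearMap
    { toFun := fun M => M.1 0 0 • LinearMap.id +
        M.1 1 0 • (LinearMap.inr 𝕜 _ _ ∘ₗ D ∘ₗ LinearMap.fst 𝕜 _ _)
      map_add' := fun M N => by
        simp only [Subalgebra.coe_add, Matrix.add_apply, add_smul]; abel
      map_smul' := fun r M => by
        simp only [Subalgebra.coe_smul, Matrix.smul_apply, smul_assoc, smul_add, RingHom.id_apply] }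
    (LinearMap.ext fun w => by simp)
    (by
      rintro ⟨_, a, b, rfl⟩ ⟨_, a', b', rfl⟩
      refine LinearMap.ext fun w => ?_
      ext1
      · simp [mul_smul]
      · simp [mul_smul, add_smul]
        rw [smul_comm b a']
        abel)

theorem algAAction_apply (M : algA 𝕜) (u v : SmoothCircle 𝕜) :
    algAAction M (u, v) = (M.1 0 0 • u, M.1 0 0 • v + M.1 1 0 • D u) := by
  simp [algAAction]

/-- The action of `algB` on pairs of functions: its off-diagonal generators act by the derivative
and the integral. -/
noncomputable def algBAction :
    algB 𝕜 →ₐ[𝕜] Module.End 𝕜 (SmoothCircle 𝕜 × SmoothCircle 𝕜) :=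
  AlgHom.ofLinearMap
    { toFun := fun M =>
        LinearMap.prod (M.1 0 0 • LinearMap.fst 𝕜 _ _ +
            M.1 0 3 • (mean.smulRight (1 : SmoothCircle 𝕜) ∘ₗ LinearMap.snd 𝕜 _ _))
          (M.1 2 2 • LinearMap.snd 𝕜 _ _ + M.1 2 1 • (D ∘ₗ LinearMap.fst 𝕜 _ _))
      map_add' := fun M N => LinearMap.ext fun w => by
        ext1
        · simp [add_smul]; abel
        · simp [add_smul]; abel
      map_smul' := fun r M => LinearMap.ext fun w => by
        simp [mul_smul] }
    (LinearMap.ext fun w => by simp)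
    (by
      rintro ⟨_, a, b, c, d, rfl⟩ ⟨_, a', b', c', d', rfl⟩
      refine LinearMap.ext fun w => ?_
      ext1
      · simp [Matrix.mul_apply, Fin.sum_univ_four, mul_smul, add_smul, mean_D]
        abel
      · simp [Matrix.mul_apply, Fin.sum_univ_four, mul_smul, add_smul, D_one]
        abel)

theorem algBAction_apply (M : algB 𝕜) (u v : SmoothCircle 𝕜) :
    algBAction M (u, v) =
      (M.1 0 0 • u + (M.1 0 3 * mean v) • 1, M.1 2 2 • v + M.1 2 1 • D u) := by
  simp [algBAction, mul_smul]

end DiffOps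

namespace DiffOps

open SmoothCircle Density

variable {𝕜 : Type*} [RCLike 𝕜]

theorem smul_one_injective {a b : 𝕜} (h : a • (1 : SmoothCircle 𝕜) = b • 1) : a = b := by
  have := congrArg (fun φ : SmoothCircle 𝕜 => φ.1 0) h
  simpa [coe_smul_apply, coe_one_apply] using this

theorem smul_D_sine_injective {a b : 𝕜}
    (h : a • D (ofReal (sine 1) : SmoothCircle 𝕜) = b • D (ofReal (sine 1))) : a = b := by
  have := congrArg (fun φ : SmoothCircle 𝕜 => φ.1 0) h
  simpa [coe_smul_apply, D_ofReal, D_sine] using this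

theorem scalarAction_injective :
    Function.Injective (scalarAction (𝕜 := 𝕜)) := fun c d h => by
  have h₁ := LinearMap.congr_fun h (1, 1)
  rw [scalarAction_apply, scalarAction_apply] at h₁
  funext i
  fin_cases i
  · exact smul_one_injective (Prod.mk.inj h₁).1
  · exact smul_one_injective (Prod.mk.inj h₁).2

theorem algAAction_injective :
    Function.Injective (algAAction (𝕜 := 𝕜)) := by
  rintro ⟨_, a, b, rfl⟩ ⟨_, a', b', rfl⟩ h
  have h₁ := LinearMap.congr_fun h (1, 0)
  have h₂ := LinearMap.congr_fun h (ofReal (sine 1), 0)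
  rw [algAAction_apply, algAAction_apply, Prod.mk.injEq] at h₁ h₂
  have e₁ : a = a' := smul_one_injective h₁.1
  have e₂ : b = b' := smul_D_sine_injective (by simpa using h₂.2)
  rw [e₁, e₂]

theorem algBAction_injective :
    Function.Injective (algBAction (𝕜 := 𝕜)) := by
  rintro ⟨_, a, b, c, d, rfl⟩ ⟨_, a', b', c', d', rfl⟩ h
  have h₁ := LinearMap.congr_fun h (1, 0)
  have h₂ := LinearMap.congr_fun h (ofReal (sine 1), 0)
  have h₃ := LinearMap.congr_fun h (0, 1)
  rw [algBAction_apply, algBAction_apply, Prod.mk.injEq] at h₁ h₂ h₃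
  have e₁ : a = a' := smul_one_injective (by simpa using h₁.1)
  have e₂ : b = b' := smul_one_injective (by simpa using h₃.2)
  have e₃ : c = c' := smul_D_sine_injective (by simpa using h₂.2)
  have e₄ : d = d' := smul_one_injective (by simpa [mean_one] using h₃.1)
  rw [e₁, e₂, e₃, e₄]

end DiffOps

/-! ### The three cases -/

theorem theorem3p6 {𝕜 : Type*} [RCLike 𝕜] (lam mu : 𝕜) :
    (mu - lam ≠ 1 → Nonempty (symmetryAlgebra 1 lam mu ≃ₐ[𝕜] (Fin 2 → 𝕜))) ∧
    (mu - lam = 1 → lam ≠ 0 → Nonempty (symmetryAlgebra 1 lam mu ≃ₐ[𝕜] algA 𝕜)) ∧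
    (lam = 0 → mu = 1 → Nonempty (symmetryAlgebra 1 lam mu ≃ₐ[𝕜] algB 𝕜)) := by
  refine ⟨fun h => ?_, fun h hlam => ?_, ?_⟩
  · have hα : mu - lam - 1 ≠ 0 := sub_ne_zero.2 h
    -- This `κ` solves `κ (mu - lam - 1) = lam`, which removes the cocycle.
    refine DiffOps.nonempty_symmetryAlgebra_equiv (lam / (mu - lam - 1)) DiffOps.scalarAction
      DiffOps.scalarAction_injective fun S => ?_
    have key := DiffOps.commute_iff_of_ne_zero (S := S) hα
    rw [sub_add_cancel] at key
    rw [div_mul_cancel₀ _ hα, sub_self, ← key]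
    constructor
    · rintro ⟨c, rfl⟩
      exact ⟨c 0, c 1, DiffOps.scalarAction_apply c⟩
    · rintro ⟨a, b, hS⟩
      exact ⟨![a, b], LinearMap.ext fun w => (hS w.1 w.2).symm⟩
  -- When `mu - lam = 1` the coefficient is `-lam` for every `κ`, so `0` serves.
  · refine DiffOps.nonempty_symmetryAlgebra_equiv 0 DiffOps.algAAction
      DiffOps.algAAction_injective fun S => ?_
    rw [h, sub_self, zero_mul, zero_sub, ← DiffOps.commute_iff_of_cocycle (neg_ne_zero.2 hlam)]
    constructor
    · rintro ⟨M, rfl⟩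
      exact ⟨M.1 0 0, M.1 1 0, DiffOps.algAAction_apply M⟩
    · rintro ⟨a, b, hS⟩
      refine ⟨⟨!![a, 0; b, a], a, b, rfl⟩, LinearMap.ext fun w => ?_⟩
      exact (DiffOps.algAAction_apply _ w.1 w.2).trans (hS w.1 w.2).symm
  · rintro rfl rfl
    refine DiffOps.nonempty_symmetryAlgebra_equiv 0 DiffOps.algBAction
      DiffOps.algBAction_injective fun S => ?_
    rw [sub_zero, sub_self, zero_mul, sub_zero, ← DiffOps.commute_iff_of_zero_zero]
    constructor
    · rintro ⟨M, rfl⟩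
      exact ⟨M.1 0 0, M.1 2 2, M.1 2 1, M.1 0 3, DiffOps.algBAction_apply M⟩
    · rintro ⟨a, b, c, d, hS⟩
      refine ⟨⟨!![a, 0, 0, d; 0, a, 0, 0; 0, c, b, 0; 0, 0, 0, b], a, b, c, d, rfl⟩,
        LinearMap.ext fun w => ?_⟩
      exact (DiffOps.algBAction_apply _ w.1 w.2).trans (hS w.1 w.2).symm
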